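/- Let $H\neq\{0\}$ be a real separable Hilbert space with complexification $H_{\mathbb C}=H+iH$. Let $X=\{X(h):h\in H\}$ and $Y=\{Y(h):h\in H\}$ be independent isonormal Gaussian processes over $H$ on a probability space $(\Omega,\mathcal F,P)$, i.e. centered real Gaussian families with $E[X(g)X(h)]=E[Y(g)Y(h)]=\langle g,h\rangle_H$. For $\mathfrak h=f+ig\in H_{\mathbb C}$ put $$Z(\mathfrak h)=\tfrac1{\sqrt2}\bigl(X(f)+iX(g)+i\,(Y(f)+iY(g))\bigr).$$ Let $J_{m,n}(z)=2^{m+n}(\partial^*)^m(\bar\partial^*)^n1$ be the complex Hermite polynomials, where $\partial^*\phi=-\frac{\partial\phi}{\partial\bar z}+\frac z2\phi$ and $\bar\partial^*\phi=-\frac{\partial\phi}{\partial z}+\frac{\bar z}2\phi$. For $m,n\ge0$ let $\mathscr H_{m,n}(Z)$ be the closed linear subspace of $L^2_{\mathbb C}(\Omega)$ generated by the random variables $J_{m,n}(Z(\mathfrak h))$ with $\mathfrak h\in H_{\mathbb C}$, $\|\mathfrak h\|=\sqrt2$ (these are square integrable). Let $\{\mathfrak e_k\}$ be a complete orthonormal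 system of $H_{\mathbb C}$. For families $\mathbf m=(m_k)$, $\mathbf n=(n_k)$ of nonnegative integers with finite sums $|\mathbf m|=\sum_k m_k$, $|\mathbf n|=\sum_k n_k$, put $\mathbf m!=\prod_k m_k!$ and $$\mathbf J_{\mathbf m,\mathbf n}=\prod_k\frac1{\sqrt{2^{m_k+n_k}\,m_k!\,n_k!}}\,J_{m_k,n_k}\bigl(\sqrt2\,Z(\mathfrak e_k)\bigr).$$ Then for all $m,n\ge0$: (i) The random variables $\mathbf J_{\mathbf m,\mathbf n}$ with $|\mathbf m|=m$, $|\mathbf n|=n$ are square integrable and form a complete orthonormal system of $\mathscr H_{m,n}(Z)$. (ii) Let $H_{\mathbb C}^{\odot m}\otimes H_{\mathbb C}^{\odot n}\subset H_{\mathbb C}^{\otimes(m+n)}$ be the Hilbert space tensor product of the symmetric tensor powers, and let $\bar{\mathfrak h}=f-ig$ for $\mathfrak h=f+ig$. There is a unique continuous linear map $\mathscr I_{m,n}:H_{\mathbb C}^{\odot m}\otimes H_{\mathbb C}^{\odot n}\to L^2_{\mathbb C}(\Omega)$ such that $$\mathscr I_{m,n}\Bigl(\mathrm{symm}\bigl(\otimes_k\mathfrak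 e_k^{\otimes m_k}\bigr)\otimes\mathrm{symm}\bigl(\otimes_k\bar{\mathfrak e}_k^{\otimes n_k}\bigr)\Bigr)=\sqrt{\mathbf m!\,\mathbf n!}\;\mathbf J_{\mathbf m,\mathbf n}\qquad(|\mathbf m|=m,\ |\mathbf n|=n).$$ It satisfies $\|\mathscr I_{m,n}(f)\|_{L^2_{\mathbb C}(\Omega)}=\sqrt{m!\,n!}\,\|f\|_{H_{\mathbb C}^{\otimes(m+n)}}$ for all $f$, and its range is $\mathscr H_{m,n}(Z)$. In other words, it is an isometry from $H_{\mathbb C}^{\odot m}\otimes H_{\mathbb C}^{\odot n}$, equipped with the norm $\sqrt{m!n!}\,\|\cdot\|_{H_{\mathbb C}^{\otimes(m+n)}}$, onto $\mathscr H_{m,n}(Z)$. -/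

import Mathlib

open MeasureTheory ProbabilityTheory
open scoped TensorProduct Nat ComplexConjugate

set_option linter.unusedSectionVars false

noncomputable section

namespace ComplexChaos

/-! ### The complexification of a real Hilbert space -/

/-- The complexification `H_ℂ = H + iH` of a real inner product space `H`: the vector `f + ig` is the
pair `(f, g)`, with norm `‖f + ig‖² = ‖f‖² + ‖g‖²`. -/
def Complexification (H : Type*) : Type _ := WithLp 2 (H × H)

namespace Complexification

variable {H : Type*} [NormedAddCommGroup H] [InnerProductSpace ℝ H]

instance : NormedAddCommGroup (Complexification H) :=
  inferInstanceAs (NormedAddCommGroup (WithLp 2 (H × H)))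

instance [CompleteSpace H] : CompleteSpace (Complexification H) :=
  inferInstanceAs (CompleteSpace (WithLp 2 (H × H)))

/-- The vector `f + ig`. -/
def mk (f g : H) : Complexification H := WithLp.toLp 2 (f, g)

/-- The real part `f` of `f + ig`. -/
def re (h : Complexification H) : H := WithLp.fst h

/-- The imaginary part `g` of `f + ig`. -/
def im (h : Complexification H) : H := WithLp.snd h

@[simp] theorem re_mk (f g : H) : (mk f g).re = f := rfl
@[simp] theorem im_mk (f g : H) : (mk f g).im = g := rfl

@[ext] theorem ext {h k : Complexification H} (h1 : h.re = k.re) (h2 : h.im = k.im) : h = k :=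
  WithLp.ofLp_injective 2 (Prod.ext h1 h2)

@[simp] theorem re_add (h k : Complexification H) : (h + k).re = h.re + k.re := rfl
@[simp] theorem im_add (h k : Complexification H) : (h + k).im = h.im + k.im := rfl
@[simp] theorem re_zero : (0 : Complexification H).re = 0 := rfl
@[simp] theorem im_zero : (0 : Complexification H).im = 0 := rfl

theorem norm_sq_eq (h : Complexification H) : ‖h‖ ^ 2 = ‖h.re‖ ^ 2 + ‖h.im‖ ^ 2 :=
  WithLp.prod_norm_sq_eq_of_L2 (α := H) (β := H) h

/-- `(a + ib)(f + ig) = (af - bg) + i(ag + bf)`. -/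
instance : SMul ℂ (Complexification H) where
  smul c h := mk (c.re • h.re - c.im • h.im) (c.re • h.im + c.im • h.re)

@[simp] theorem re_smul (c : ℂ) (h : Complexification H) :
    (c • h).re = c.re • h.re - c.im • h.im := rfl
@[simp] theorem im_smul (c : ℂ) (h : Complexification H) :
    (c • h).im = c.re • h.im + c.im • h.re := rfl

instance : Module ℂ (Complexification H) where
  one_smul h := by ext <;> simp
  mul_smul c d h := by ext <;> simp <;> module
  smul_zero c := by ext <;> simp
  smul_add c h k := by ext <;> simp <;> abel
  add_smul c d h := by ext <;> simp <;> module
  zero_smul h := by ext <;> simp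

/-- The Hermitian inner product of `H_ℂ`; as everywhere in Mathlib it is conjugate-linear in the
first argument and linear in the second one. -/
instance : InnerProductSpace ℂ (Complexification H) where
  norm_smul_le c h := by
    apply le_of_eq
    rw [← sq_eq_sq₀ (by positivity) (by positivity), mul_pow, norm_sq_eq, norm_sq_eq,
      Complex.sq_norm, Complex.normSq_apply, re_smul, im_smul, norm_sub_sq_real, norm_add_sq_real]
    simp only [norm_smul, mul_pow, Real.norm_eq_abs, sq_abs, real_inner_smul_left,
      real_inner_smul_right, real_inner_comm h.re h.im]
    ring
  inner h k := ⟨inner ℝ h.re k.re + inner ℝ h.im k.im, inner ℝ h.re k.im - inner ℝ h.im k.re⟩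
  norm_sq_eq_re_inner h := by
    simp [norm_sq_eq]
  conj_inner_symm h k := by
    apply Complex.ext <;> simp [real_inner_comm]
  add_left h k l := by
    apply Complex.ext <;> simp [inner_add_left] <;> ring
  smul_left h k c := by
    apply Complex.ext <;>
      simp [inner_add_left, inner_sub_left, real_inner_smul_left] <;> ring

/-- The complex conjugation `f + ig ↦ f - ig` of `H_ℂ`. -/
def conjugate (h : Complexification H) : Complexification H := mk h.re (-h.im)

end Complexification

/-! ### Hilbert space tensor powers -/

/-- The algebraic tensor product of copies of `K` indexed by `κ`, carrying the inner product
`⟪⊗ vᵢ, ⊗ wᵢ⟫ = ∏ ⟪vᵢ, wᵢ⟫` (and not one of the Banach space cross norms). -/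
def PreTensor (κ K : Type*) [NormedAddCommGroup K] [InnerProductSpace ℂ K] : Type _ :=
  ⨂[ℂ] _ : κ, K

namespace PreTensor

variable {κ K : Type*} [NormedAddCommGroup K] [InnerProductSpace ℂ K]

instance : AddCommGroup (PreTensor κ K) := inferInstanceAs (AddCommGroup (⨂[ℂ] _ : κ, K))
instance : Module ℂ (PreTensor κ K) := inferInstanceAs (Module ℂ (⨂[ℂ] _ : κ, K))

variable [Fintype κ]

/-- The linear functional `⊗ vᵢ ↦ ∏ ⟪yᵢ, vᵢ⟫`. -/
def innerAux (y : κ → K) : (⨂[ℂ] _ : κ, K) →ₗ[ℂ] ℂ :=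
  PiTensorProduct.lift
    ((MultilinearMap.mkPiAlgebra ℂ κ ℂ).compLinearMap fun i => innerₛₗ ℂ (y i))

theorem innerAux_tprod (y v : κ → K) :
    innerAux y (PiTensorProduct.tprod ℂ v) = ∏ i, inner ℂ (y i) (v i) := by
  simp [innerAux]

theorem innerAux_add [DecidableEq κ] (y : κ → K) (i : κ) (a b : K) (x : ⨂[ℂ] _ : κ, K) :
    innerAux (Function.update y i (a + b)) x =
      innerAux (Function.update y i a) x + innerAux (Function.update y i b) x := by
  induction x using PiTensorProduct.induction_on with
  | smul_tprod r v =>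
    simp only [map_smul, innerAux_tprod, ← smul_add]
    congr 1
    simp only [← Finset.mul_prod_erase _ _ (Finset.mem_univ i), Function.update_self,
      inner_add_left, add_mul]
    congr 1 <;> congr 1 <;> refine Finset.prod_congr rfl fun j hj => ?_ <;>
      simp [Function.update_of_ne (Finset.ne_of_mem_erase hj)]
  | add x y hx hy => simp only [map_add, hx, hy]; ring

theorem innerAux_smul [DecidableEq κ] (y : κ → K) (i : κ) (c : ℂ) (a : K) (x : ⨂[ℂ] _ : κ, K) :
    innerAux (Function.update y i (c • a)) x = conj c * innerAux (Function.update y i a) x := by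
  induction x using PiTensorProduct.induction_on with
  | smul_tprod r v =>
    simp only [map_smul, innerAux_tprod, smul_eq_mul]
    simp only [← Finset.mul_prod_erase _ _ (Finset.mem_univ i), Function.update_self,
      inner_smul_left]
    have h : ∏ j ∈ Finset.univ.erase i, inner ℂ (Function.update y i (c • a) j) (v j) =
        ∏ j ∈ Finset.univ.erase i, inner ℂ (Function.update y i a j) (v j) :=
      Finset.prod_congr rfl fun j hj => by
        simp [Function.update_of_ne (Finset.ne_of_mem_erase hj)]
    rw [h]
    ring
  | add x y hx hy => simp only [map_add, hx, hy]; ring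

/-- The functional `⊗ vᵢ ↦ ∏ ⟪vᵢ, yᵢ⟫`, which is conjugate-linear. -/
def innerConj (y : κ → K) : (⨂[ℂ] _ : κ, K) →ₗ⋆[ℂ] ℂ where
  toFun x := conj (innerAux y x)
  map_add' := by simp
  map_smul' := by simp

/-- The inner product, as a form linear in `y` (the first argument below) and conjugate-linear
in `x` (the second one). -/
def innerForm : (⨂[ℂ] _ : κ, K) →ₗ[ℂ] (⨂[ℂ] _ : κ, K) →ₗ⋆[ℂ] ℂ :=
  PiTensorProduct.lift
    { toFun := innerConj
      map_update_add' := by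
        intro _ y i a b
        ext x
        simp [innerConj, innerAux_add]
      map_update_smul' := by
        intro _ y i c a
        ext x
        simp [innerConj, innerAux_smul] }

theorem innerForm_tprod (v w : κ → K) :
    innerForm (PiTensorProduct.tprod ℂ w) (PiTensorProduct.tprod ℂ v) =
      ∏ i, inner ℂ (v i) (w i) := by
  simp [innerForm, innerConj, innerAux_tprod]

theorem innerForm_symm (x y : ⨂[ℂ] _ : κ, K) : conj (innerForm x y) = innerForm y x := by
  induction x using PiTensorProduct.induction_on with
  | smul_tprod r w =>
    induction y using PiTensorProduct.induction_on with
    | smul_tprod s v =>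
      simp [innerForm_tprod, mul_left_comm]
    | add y z hy hz => simp only [map_add, LinearMap.add_apply, hy, hz]
  | add x z hx hz => simp only [map_add, LinearMap.add_apply, hx, hz]

open ComplexOrder in
/-- Products of Gram matrices are positive semidefinite. -/
theorem posSemidef_prod_gram {σ : Type*} [Fintype σ] (v : σ → κ → K) :
    (Matrix.of fun a b => ∏ i, inner ℂ (v a i) (v b i) : Matrix σ σ ℂ).PosSemidef := by
  classical
  suffices h : ∀ t : Finset κ,
      (Matrix.of fun a b => ∏ i ∈ t, inner ℂ (v a i) (v b i) : Matrix σ σ ℂ).PosSemidef from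
    h Finset.univ
  intro t
  induction t using Finset.induction_on with
  | empty =>
    have h : (Matrix.of fun a b => ∏ i ∈ (∅ : Finset κ), inner ℂ (v a i) (v b i) :
        Matrix σ σ ℂ) = Matrix.gram ℂ (fun _ : σ => (1 : ℂ)) := by
      ext a b; simp
    rw [h]
    exact Matrix.posSemidef_gram ℂ _
  | insert i t hi ih =>
    have h : (Matrix.of fun a b => ∏ j ∈ insert i t, inner ℂ (v a j) (v b j) :
        Matrix σ σ ℂ) = (Matrix.gram ℂ (fun a : σ => v a i)).hadamard
          (Matrix.of fun a b => ∏ j ∈ t, inner ℂ (v a j) (v b j)) := by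
      ext a b; simp [Finset.prod_insert hi]
    rw [h]
    exact (Matrix.posSemidef_gram ℂ _).hadamard ih

open ComplexOrder in
theorem innerForm_self_nonneg (x : ⨂[ℂ] _ : κ, K) : 0 ≤ (innerForm x x).re := by
  have hx : x ∈ Submodule.span ℂ (Set.range (PiTensorProduct.tprod ℂ (s := fun _ : κ => K))) := by
    rw [PiTensorProduct.span_tprod_eq_top]; trivial
  obtain ⟨c, rfl⟩ := Finsupp.mem_span_range_iff_exists_finsupp.1 hx
  have h := (posSemidef_prod_gram (fun v : c.support => (v : κ → K))).dotProduct_mulVec_nonneg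
    (fun v => c v)
  refine ((Complex.le_def.1 h).1).trans_eq (congrArg Complex.re ?_)
  simp only [Finsupp.sum, map_sum, LinearMap.sum_apply, map_smulₛₗ, LinearMap.smul_apply,
    innerForm_tprod, dotProduct, Matrix.mulVec, Matrix.of_apply, Finset.mul_sum, Pi.star_apply]
  rw [← Finset.sum_coe_sort c.support]
  refine Finset.sum_congr rfl fun a _ => ?_
  rw [← Finset.sum_coe_sort c.support, Finset.smul_sum]
  refine Finset.sum_congr rfl fun b _ => ?_
  simp only [smul_eq_mul, RingHom.id_apply, starRingEnd_apply]
  ring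

instance : PreInnerProductSpace.Core ℂ (PreTensor κ K) where
  inner x y := innerForm (κ := κ) (K := K) y x
  conj_inner_symm x y := innerForm_symm (κ := κ) (K := K) x y
  re_inner_nonneg x := innerForm_self_nonneg (κ := κ) (K := K) x
  add_left x y z := (innerForm (κ := κ) (K := K) z).map_add x y
  smul_left x y r := (innerForm (κ := κ) (K := K) y).map_smulₛₗ r x

instance : SeminormedAddCommGroup (PreTensor κ K) :=
  InnerProductSpace.Core.toSeminormedAddCommGroup (𝕜 := ℂ)

instance : InnerProductSpace ℂ (PreTensor κ K) := InnerProductSpace.ofCore _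

/-- The elementary tensor `⊗ vᵢ`. -/
def pure (v : κ → K) : PreTensor κ K := PiTensorProduct.tprod ℂ v

theorem inner_pure (v w : κ → K) :
    inner ℂ (pure v) (pure w) = ∏ i, inner ℂ (v i) (w i) :=
  innerForm_tprod v w

/-- The tensor product `a ⊗ b ∈ K^{⊗(m+n)}` of `a ∈ K^{⊗m}` and `b ∈ K^{⊗n}`; the `m + n` factors
of `K^{⊗(m+n)}` are indexed by `Fin m ⊕ Fin n`. -/
def tmul {m n : ℕ} (a : PreTensor (Fin m) K) (b : PreTensor (Fin n) K) :
    PreTensor (Fin m ⊕ Fin n) K :=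
  PiTensorProduct.tmulEquiv ℂ K (TensorProduct.tmul ℂ a b)

/-- The action of a permutation of the factors on `K^{⊗m}`. -/
def permute {m : ℕ} (σ : Equiv.Perm (Fin m)) : PreTensor (Fin m) K →ₗ[ℂ] PreTensor (Fin m) K :=
  (PiTensorProduct.reindex ℂ (fun _ : Fin m => K) σ).toLinearMap

/-- The symmetrization `symm(v₁ ⊗ ⋯ ⊗ vₘ) = (1/m!) ∑_σ v_{σ 1} ⊗ ⋯ ⊗ v_{σ m}` on `K^{⊗m}`. -/
def symm {m : ℕ} : PreTensor (Fin m) K →ₗ[ℂ] PreTensor (Fin m) K :=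
  (m ! : ℂ)⁻¹ • ∑ σ : Equiv.Perm (Fin m), permute σ

theorem tmul_pure {m n : ℕ} (v : Fin m → K) (w : Fin n → K) :
    tmul (pure v) (pure w) = pure (Sum.elim v w) :=
  PiTensorProduct.tmulEquiv_apply ℂ K v w

theorem permute_pure {m : ℕ} (σ : Equiv.Perm (Fin m)) (v : Fin m → K) :
    permute σ (pure v) = pure (fun i => v (σ.symm i)) :=
  PiTensorProduct.reindex_tprod σ v

theorem symm_pure {m : ℕ} (v : Fin m → K) :
    symm (pure v) = (m ! : ℂ)⁻¹ • ∑ σ : Equiv.Perm (Fin m), pure (fun i => v (σ i)) := by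
  simp only [symm, LinearMap.smul_apply, LinearMap.sum_apply, permute_pure]
  congr 1
  exact Equiv.sum_comp (Equiv.inv (Equiv.Perm (Fin m))) fun σ => pure fun i => v (σ i)

end PreTensor

/-- The Hilbert space tensor product of copies of `K` indexed by `κ`: the completion of the algebraic
tensor product. -/
def HilbertTensor (κ K : Type*) [Fintype κ] [NormedAddCommGroup K] [InnerProductSpace ℂ K] :
    Type _ :=
  UniformSpace.Completion (PreTensor κ K)

namespace HilbertTensor

variable {κ K : Type*} [Fintype κ] [NormedAddCommGroup K] [InnerProductSpace ℂ K]

instance : NormedAddCommGroup (HilbertTensor κ K) :=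
  inferInstanceAs (NormedAddCommGroup (UniformSpace.Completion (PreTensor κ K)))

instance : InnerProductSpace ℂ (HilbertTensor κ K) :=
  inferInstanceAs (InnerProductSpace ℂ (UniformSpace.Completion (PreTensor κ K)))

instance : CompleteSpace (HilbertTensor κ K) :=
  inferInstanceAs (CompleteSpace (UniformSpace.Completion (PreTensor κ K)))

/-- The canonical isometric embedding of the algebraic tensor product with dense range. -/
def of : PreTensor κ K →ₗᵢ[ℂ] HilbertTensor κ K :=
  UniformSpace.Completion.toComplₗᵢ

end HilbertTensor

/-- The vector `symm(v₁ ⊗ ⋯ ⊗ vₘ) ⊗ symm(w₁ ⊗ ⋯ ⊗ wₙ)` of `K^{⊗(m+n)}`. -/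
def symmTensor {K : Type*} [NormedAddCommGroup K] [InnerProductSpace ℂ K] {m n : ℕ}
    (v : Fin m → K) (w : Fin n → K) : HilbertTensor (Fin m ⊕ Fin n) K :=
  HilbertTensor.of (PreTensor.tmul (PreTensor.symm (PreTensor.pure v))
    (PreTensor.symm (PreTensor.pure w)))

/-- The Hilbert space `K^{⊙m} ⊗ K^{⊙n}`, as the closed subspace of `K^{⊗(m+n)}` generated by the
products `symm(a) ⊗ symm(b)` of symmetric tensors. -/
def symPowTensorSymPow (K : Type*) [NormedAddCommGroup K] [InnerProductSpace ℂ K] (m n : ℕ) :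
    Submodule ℂ (HilbertTensor (Fin m ⊕ Fin n) K) :=
  (Submodule.span ℂ {t | ∃ (a : PreTensor (Fin m) K) (b : PreTensor (Fin n) K),
    t = HilbertTensor.of (PreTensor.tmul (PreTensor.symm a) (PreTensor.symm b))}).topologicalClosure

theorem symmTensor_mem {K : Type*} [NormedAddCommGroup K] [InnerProductSpace ℂ K] {m n : ℕ}
    (v : Fin m → K) (w : Fin n → K) : symmTensor v w ∈ symPowTensorSymPow K m n :=
  Submodule.le_topologicalClosure _ (Submodule.subset_span ⟨_, _, rfl⟩)

/-! ### Complex Hermite polynomials -/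

/-- `∂u/∂z = (1/2)(∂u/∂x - i ∂u/∂y)`. -/
def dz (u : ℂ → ℂ) (z : ℂ) : ℂ :=
  (1 / 2) * (fderiv ℝ u z 1 - Complex.I * fderiv ℝ u z Complex.I)

/-- `∂u/∂z̄ = (1/2)(∂u/∂x + i ∂u/∂y)`. -/
def dzBar (u : ℂ → ℂ) (z : ℂ) : ℂ :=
  (1 / 2) * (fderiv ℝ u z 1 + Complex.I * fderiv ℝ u z Complex.I)

/-- The creation operator `∂* u = -∂u/∂z̄ + (z/ρ) u`. -/
def creation (ρ : ℝ) (u : ℂ → ℂ) : ℂ → ℂ :=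
  fun z => -dzBar u z + z / ρ * u z

/-- The creation operator `∂̄* u = -∂u/∂z + (z̄/ρ) u`. -/
def creationBar (ρ : ℝ) (u : ℂ → ℂ) : ℂ → ℂ :=
  fun z => -dz u z + conj z / ρ * u z

/-- The complex Hermite polynomial `J_{m,n}(z, ρ) = ρ^{m+n} (∂*)^m (∂̄*)^n 1`. -/
def hermiteJρ (ρ : ℝ) (m n : ℕ) : ℂ → ℂ :=
  fun z => (ρ : ℂ) ^ (m + n) * (creation ρ)^[m] ((creationBar ρ)^[n] fun _ => 1) z

/-- `J_{m,n}(z) = J_{m,n}(z, 2)`. -/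
def hermiteJ (m n : ℕ) : ℂ → ℂ := hermiteJρ 2 m n

/-! ### Isonormal Gaussian processes and complex Wiener-Itô chaos -/

section ChaosSpaces

variable {Ω : Type*} [MeasurableSpace Ω] {H : Type*} [NormedAddCommGroup H] [InnerProductSpace ℝ H]

/-- `X = {X(h) : h ∈ H}` is an isonormal Gaussian process over the real Hilbert space `H`: a centered
Gaussian family with `E[X(g) X(h)] = ⟪g, h⟫`. -/
structure IsIsonormal (X : H → Ω → ℝ) (P : Measure Ω) : Prop where
  isGaussianProcess : IsGaussianProcess X P
  centered : ∀ h, ∫ ω, X h ω ∂P = 0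
  covariance : ∀ g h, ∫ ω, X g ω * X h ω ∂P = inner ℝ g h

/-- `X_ℂ(f + ig) = X(f) + i X(g)`. -/
def complexify (X : H → Ω → ℝ) (h : Complexification H) (ω : Ω) : ℂ :=
  X h.re ω + Complex.I * X h.im ω

/-- The complex isonormal Gaussian process `Z(h) = (X_ℂ(h) + i Y_ℂ(h)) / √2` over `H_ℂ`. -/
def complexIsonormal (X Y : H → Ω → ℝ) (h : Complexification H) (ω : Ω) : ℂ :=
  (complexify X h ω + Complex.I * complexify Y h ω) / (√2 : ℝ)

/-- The chaos `ℋ_{m,n}(Z)`: the closed linear subspace of `L²_ℂ(Ω)` generated by the random variables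
`J_{m,n}(Z(h))` with `‖h‖ = √2`. -/
def chaos (P : Measure Ω) (Z : Complexification H → Ω → ℂ) (m n : ℕ) : Submodule ℂ (Lp ℂ 2 P) :=
  (Submodule.span ℂ {F : Lp ℂ 2 P | ∃ h : Complexification H, ‖h‖ = √2 ∧
    F =ᵐ[P] fun ω => hermiteJ m n (Z h ω)}).topologicalClosure

/-- `μ! = ∏ₖ μₖ!`. -/
def multiFactorial {ι : Type*} (μ : ι →₀ ℕ) : ℕ := μ.prod fun _ j => j !

/-- The complex Fourier-Hermite polynomial
`𝐉_{μ,ν} = ∏ₖ (2^{μₖ+νₖ} μₖ! νₖ!)^{-1/2} J_{μₖ,νₖ}(√2 Z(eₖ))`. The factors with `μₖ = νₖ = 0` are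
equal to `1`, so that the product runs over the finite set of the other `k`. -/
def fourierHermite {ι : Type*} (Z : Complexification H → Ω → ℂ) (e : ι → Complexification H)
    (μ ν : ι →₀ ℕ) (ω : Ω) : ℂ :=
  ∏ k ∈ (μ + ν).support,
    ((1 / √(2 ^ (μ k + ν k) * (μ k)! * (ν k)! : ℝ) : ℝ) : ℂ) *
      hermiteJ (μ k) (ν k) ((√2 : ℝ) * Z (e k) ω)

/-- The multi-index of a list `a` of indices: its value at `k` is the number of `j` with `a j = k`. So
`⊗ⱼ e_{a j}` is, up to the order of its factors, the tensor `⊗ₖ eₖ^{⊗ μₖ}` with `μ = multiIndex a`. -/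
def multiIndex {ι : Type*} {m : ℕ} (a : Fin m → ι) : ι →₀ ℕ := ∑ j, Finsupp.single (a j) 1

/-- The formula defining the complex multiple Wiener-Itô integral on basis tensors:
`I(symm(⊗ₖ eₖ^{⊗ μₖ}) ⊗ symm(⊗ₖ ēₖ^{⊗ νₖ})) = √(μ! ν!) 𝐉_{μ,ν}` in `L²_ℂ(Ω)`, for all `|μ| = m`, `|ν| = n`
and all orderings `a`, `b` of the factors. -/
def IsIntegralOnBasis {ι : Type*} (P : Measure Ω) (Z : Complexification H → Ω → ℂ)
    (e : ι → Complexification H) (m n : ℕ)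
    (I : symPowTensorSymPow (Complexification H) m n →L[ℂ] Lp ℂ 2 P) : Prop :=
  ∀ (μ ν : ι →₀ ℕ) (a : Fin m → ι) (b : Fin n → ι), multiIndex a = μ → multiIndex b = ν →
    I ⟨symmTensor (fun j => e (a j)) (fun j => (e (b j)).conjugate), symmTensor_mem _ _⟩
      =ᵐ[P] fun ω => ((√(multiFactorial μ * multiFactorial ν : ℝ) : ℝ) : ℂ) *
        fourierHermite Z e μ ν ω

end ChaosSpaces

end ComplexChaos

end

/-! The process `Z` is circular: jointly Gaussian and centered, with E[conj Z(g) Z(h)] = ⟪g, h⟫ and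
E[Z(g) Z(h)] = 0 (`isCircularIsonormal_complexIsonormal`). Orthogonal vectors therefore give
independent variables. All Hermite polynomials are reduced to `herm r z z̄ m n`, a polynomial
carrying its variance `r`. The polynomial J_{m,n} is the case r = 2, so that J_{m,n}(Z(h)) with ‖h‖
= √2 is the case r = ‖h‖², called `hermZ`.

Three facts about these polynomials carry the proof: orthogonality under one circular Gaussian law,
by Gaussian integration by parts (`momentFunctional_herm_mul_herm`); bihomogeneity (`herm_scale`);
and the addition theorem (`herm_add`), which applies to Z(g + h) for g ⊥ h because the variances
add.

Independence extends orthogonality to products over an orthonormal basis, so the 𝐉_{μ,ν} are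
orthonormal. They span the chaos for two reasons. The addition theorem expands the Hermite variable
of a finite combination of the e_k into products with |μ| = m and |ν| = n (`hermZ_sum_mem`), and an
explicit L² distance passes to general h (`hermZ_mem_of_forall_finset`). Conversely, each product is
a coefficient of c^i c̄^j in Hermite variables of sums c e_k + r, and polarization extracts it
(`prodHerm_mem`).

On the tensor side, the vectors symm(⊗ e_k^{⊗ μ_k}) ⊗ symm(⊗ ē_k^{⊗ ν_k}) are orthogonal and total,
of squared norm μ! ν! / (m! n!), where μ! and ν! count stabilizers of index lists. Matching the two
Hilbert bases and multiplying by √(m! n!) gives the integral; totality gives uniqueness. -/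

noncomputable section

namespace ComplexChaos

/-! ### Algebra of the complex Hermite polynomials -/

section HermiteAlgebra

variable {A : Type*} [CommRing A]

/-- The complex Hermite polynomial of bidegree `(m, n)` and variance `r`, evaluated at `z = x`,
`z̄ = y` in a commutative ring. -/
def herm (r x y : A) : ℕ → ℕ → A
  | 0, n => y ^ n
  -- For `n = 0` the truncated index `n - 1` is harmless, since its coefficient vanishes.
  | m + 1, n => x * herm r x y m n - n * r * herm r x y m (n - 1)

theorem herm_zero_left (r x y : A) (n : ℕ) : herm r x y 0 n = y ^ n := by rw [herm]

theorem herm_succ_left (r x y : A) (m n : ℕ) :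
    herm r x y (m + 1) n = x * herm r x y m n - n * r * herm r x y m (n - 1) := by rw [herm]

theorem map_herm {B : Type*} [CommRing B] (f : A →+* B) (r x y : A) (m n : ℕ) :
    f (herm r x y m n) = herm (f r) (f x) (f y) m n := by
  induction m generalizing n with
  | zero => simp [herm_zero_left]
  | succ m ih => simp [herm_succ_left, ih]

/-- The definition treats the two indices asymmetrically; this second recursion restores the
symmetry and yields `herm_swap`. -/
theorem herm_succ_right (r x y : A) (m n : ℕ) :
    herm r x y m (n + 1) = y * herm r x y m n - m * r * herm r x y (m - 1) n := by
  induction m using Nat.strong_induction_on generalizing n with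
  | _ m ih =>
    rcases m with - | m
    · simp [herm_zero_left, pow_succ']
    · have e := ih m (by omega) n
      rcases n with - | n
      · rcases m with - | m
        · simp [herm_zero_left, herm_succ_left]; ring
        · rw [herm_succ_left, e]
          simp [herm_succ_left]; ring
      · rw [herm_succ_left, e, herm_succ_left r x y m (n + 1)]
        rcases m with - | m
        · simp [herm_zero_left]; ring
        · have e1 := ih (m + 1) (by omega) n
          have e2 := herm_succ_left r x y m (n + 1)
          simp only [Nat.add_sub_cancel] at e1 e2 ⊢
          push_cast at e1 e2 ⊢
          -- Both relations expand `herm r x y (m + 1) (n + 1)`, one through `x` and one through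
          -- `y`; with these weights the terms in `herm r x y m n` cancel.
          linear_combination (m + 1) * r * e2 - (n + 1) * r * e1

theorem herm_swap (r x y : A) (m n : ℕ) : herm r x y m n = herm r y x n m := by
  induction n generalizing m with
  | zero =>
    rw [herm_zero_left]
    induction m with
    | zero => simp [herm_zero_left]
    | succ m ih => simp [herm_succ_left, ih, pow_succ']
  | succ n ih => rw [herm_succ_right, herm_succ_left, ih, ih]

/-- With `d = conj c` this is the effect of replacing `z` by `c z`, which multiplies the variance by
|c|². -/
theorem herm_scale (r x y c d : A) (m n : ℕ) :
    herm (c * d * r) (c * x) (d * y) m n = c ^ m * d ^ n * herm r x y m n := by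
  induction m generalizing n with
  | zero => simp [herm_zero_left, mul_pow]
  | succ m ih =>
    rw [herm_succ_left, herm_succ_left, ih, ih]
    rcases n with - | n
    · simp; ring
    · simp; ring

theorem herm_zero_zero_zero (m n : ℕ) (h : m + n ≠ 0) : herm (0 : A) 0 0 m n = 0 := by
  rcases m with - | m
  · rw [herm_zero_left, zero_pow (by omega)]
  · simp [herm_succ_left]

theorem conj_herm (r : ℝ) (z : ℂ) (m n : ℕ) :
    conj (herm (r : ℂ) z (conj z) m n) = herm (r : ℂ) z (conj z) n m := by
  rw [map_herm, Complex.conj_ofReal, Complex.conj_conj, herm_swap]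

-- For fixed `m` this is the exponential generating function in `n`. It starts from exp(yX), and
-- multiplication by x - rX reproduces the recursion in `m`, because the factor X shifts `n` by one.
open PowerSeries in
theorem herm_eq_coeff (r x y : ℂ) (m n : ℕ) :
    herm r x y m n =
      n ! * coeff n ((C x - C r * X) ^ m * rescale y (PowerSeries.exp ℂ)) := by
  induction m generalizing n with
  | zero =>
    have : (n ! : ℂ) ≠ 0 := by exact_mod_cast n.factorial_ne_zero
    simp [herm_zero_left, coeff_rescale, coeff_exp]
    field_simp
  | succ m ih =>
    rw [herm_succ_left, pow_succ', mul_assoc (C x - C r * X), sub_mul, map_sub, coeff_C_mul,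
      mul_assoc (C r), coeff_C_mul, ih, ih]
    rcases n with - | n
    · simp
    · rw [PowerSeries.coeff_succ_X_mul, Nat.add_sub_cancel, Nat.factorial_succ]
      push_cast
      ring

-- In the generating function, (x + x') - (r + s)X splits into the two linear factors, to which the
-- binomial theorem applies, while the exponential is multiplicative. The Cauchy product supplies
-- the sum over `j`.
open PowerSeries in
theorem herm_add (r s x y x' y' : ℂ) (m n : ℕ) :
    herm (r + s) (x + x') (y + y') m n =
      ∑ i ∈ Finset.range (m + 1), ∑ j ∈ Finset.range (n + 1),
        (m.choose i * n.choose j : ℂ) *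
          (herm r x y i j * herm s x' y' (m - i) (n - j)) := by
  have h : C (x + x') - C (r + s) * X = (C x - C r * X) + (C x' - C s * X) := by
    simp only [map_add]; ring
  rw [herm_eq_coeff, h, ← exp_mul_exp_eq_exp_add, add_pow, Finset.sum_mul, map_sum,
    Finset.mul_sum]
  refine Finset.sum_congr rfl fun i _ => ?_
  have h2 : (C x - C r * X) ^ i * (C x' - C s * X) ^ (m - i) * (m.choose i : PowerSeries ℂ) *
      (rescale y (PowerSeries.exp ℂ) * rescale y' (PowerSeries.exp ℂ)) =
      C (m.choose i : ℂ) * (((C x - C r * X) ^ i * rescale y (PowerSeries.exp ℂ)) *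
        ((C x' - C s * X) ^ (m - i) * rescale y' (PowerSeries.exp ℂ))) := by
    simp only [map_natCast]; ring
  rw [h2, coeff_C_mul, coeff_mul, Finset.Nat.sum_antidiagonal_eq_sum_range_succ_mk,
    Finset.mul_sum, Finset.mul_sum]
  refine Finset.sum_congr rfl fun j hj => ?_
  have hj : j ≤ n := by simpa [Nat.lt_succ_iff] using hj
  rw [herm_eq_coeff, herm_eq_coeff]
  have : (n ! : ℂ) = n.choose j * j ! * (n - j)! := by
    exact_mod_cast (Nat.choose_mul_factorial_mul_factorial hj).symm
  rw [this]
  ring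

end HermiteAlgebra

/-! ### The analytic definition -/

section HermiteAnalytic

/-- The derivative is written in terms of the identity and conjugation, so that its coefficients are
the Wirtinger derivatives ∂/∂z and ∂/∂z̄; each lowers one index. -/
theorem hasFDerivAt_herm (r : ℂ) (m n : ℕ) (z : ℂ) :
    HasFDerivAt (fun z => herm r z (conj z) m n)
      ((m * herm r z (conj z) (m - 1) n) • (1 : ℂ →L[ℝ] ℂ) +
        (n * herm r z (conj z) m (n - 1)) • (Complex.conjCLE : ℂ →L[ℝ] ℂ)) z := by
  induction m using Nat.strong_induction_on generalizing n with
  | _ m ih =>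
    rcases m with - | m
    · simp only [herm_zero_left]
      have h := (Complex.conjCLE : ℂ →L[ℝ] ℂ).hasFDerivAt (x := z)
      refine (h.pow n).congr_fderiv ?_
      ext
      simp
    · simp only [herm_succ_left]
      have h1 := ((1 : ℂ →L[ℝ] ℂ).hasFDerivAt (x := z)).mul (ih m (by omega) n)
      have h2 := (ih m (by omega) (n - 1)).const_mul (n * r)
      refine (h1.sub h2).congr_fderiv ?_
      ext v
      rcases m with - | m <;> rcases n with - | n <;>
        simp [herm_zero_left, herm_succ_left] <;> ring

theorem dz_const_mul_herm (r c : ℂ) (m n : ℕ) (z : ℂ) :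
    dz (fun z => c * herm r z (conj z) m n) z = c * (m * herm r z (conj z) (m - 1) n) := by
  rw [dz, ((hasFDerivAt_herm r m n z).const_mul c).fderiv]
  simp
  ring_nf
  simp
  ring

theorem dzBar_const_mul_herm (r c : ℂ) (m n : ℕ) (z : ℂ) :
    dzBar (fun z => c * herm r z (conj z) m n) z = c * (n * herm r z (conj z) m (n - 1)) := by
  rw [dzBar, ((hasFDerivAt_herm r m n z).const_mul c).fderiv]
  simp
  ring_nf
  simp
  ring

theorem creationBar_iterate_one {ρ : ℝ} (hρ : ρ ≠ 0) (n : ℕ) :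
    (creationBar ρ)^[n] (fun _ => 1) =
      fun z => ((ρ : ℂ) ^ n)⁻¹ * herm (ρ : ℂ) z (conj z) 0 n := by
  have hρ' : (ρ : ℂ) ≠ 0 := by exact_mod_cast hρ
  induction n with
  | zero => ext; simp [herm_zero_left]
  | succ n ih =>
    rw [Function.iterate_succ_apply', ih]
    ext z
    rw [creationBar, dz_const_mul_herm]
    simp [herm_zero_left]
    field_simp
    ring

/-- Since ∂/∂z̄ lowers `n`, the operator ρ ∂* is exactly the recursion in `m` with r = ρ. The factor
ρ^{m+n} in the definition of J absorbs the remaining powers. -/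
theorem creation_iterate_creationBar_iterate {ρ : ℝ} (hρ : ρ ≠ 0) (m n : ℕ) :
    (creation ρ)^[m] ((creationBar ρ)^[n] (fun _ => 1)) =
      fun z => ((ρ : ℂ) ^ (m + n))⁻¹ * herm (ρ : ℂ) z (conj z) m n := by
  have hρ' : (ρ : ℂ) ≠ 0 := by exact_mod_cast hρ
  induction m with
  | zero => simp [creationBar_iterate_one hρ]
  | succ m ih =>
    rw [Function.iterate_succ_apply', ih]
    ext z
    rw [creation, dzBar_const_mul_herm, herm_succ_left, add_right_comm, pow_succ _ (m + n)]
    field_simp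
    ring

theorem hermiteJ_eq_herm (m n : ℕ) (z : ℂ) : hermiteJ m n z = herm 2 z (conj z) m n := by
  rw [hermiteJ, hermiteJρ, creation_iterate_creationBar_iterate two_ne_zero]
  simp

end HermiteAnalytic

/-! ### Orthogonality with respect to a moment functional -/

section MomentFunctional

open MvPolynomial

/-- The complex Hermite polynomial as a polynomial in `z = X false` and `z̄ = X true`. -/
def hermPoly (r : ℂ) (m n : ℕ) : MvPolynomial Bool ℂ :=
  herm (C r) (X false) (X true) m n

theorem pderiv_true_hermPoly (r : ℂ) (m n : ℕ) :
    pderiv true (hermPoly r m n) = n * hermPoly r m (n - 1) := by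
  induction m generalizing n with
  | zero =>
    simp [hermPoly, herm_zero_left]
  | succ m ih =>
    simp only [hermPoly] at ih
    simp only [hermPoly, herm_succ_left, map_sub, Derivation.leibniz, ih, pderiv_C, smul_eq_mul]
    have : pderiv true (n : MvPolynomial Bool ℂ) = 0 := Derivation.map_natCast _ _
    simp [this]
    rcases n with - | n
    · simp
    · simp; ring

/-- The moments `E[z^a z̄^b] = δ_{ab} a! r^a` of a centered circular complex Gaussian variable of
variance `r`. -/
def circularMoment (r : ℂ) (a b : ℕ) : ℂ := if a = b then a ! * r ^ a else 0

/-- Gaussian integration by parts in algebraic form: on monomials it is the identity (b + 1)! = (b +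
1) b! for the moments, and linearity does the rest. -/
theorem momentFunctional_integration_by_parts (r : ℂ) (L : MvPolynomial Bool ℂ →ₗ[ℂ] ℂ)
    (hL : ∀ a b, L (X false ^ a * X true ^ b) = circularMoment r a b) (p : MvPolynomial Bool ℂ) :
    L (X false * p) = r * L (pderiv true p) := by
  induction p using MvPolynomial.induction_on' with
  | add p q hp hq => simp only [mul_add, map_add, hp, hq]
  | monomial u c =>
    have h : monomial u c = c • ((X false : MvPolynomial Bool ℂ) ^ u false * X true ^ u true) := by
      rw [MvPolynomial.monomial_eq, Finsupp.prod_fintype _ _ (by simp)]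
      simp [MvPolynomial.smul_eq_C_mul, mul_comm]
    rw [h]
    have h2 : (X false : MvPolynomial Bool ℂ) * c • (X false ^ u false * X true ^ u true) =
      c • (X false ^ (u false + 1) * X true ^ u true) := by
      rw [mul_smul_comm]; congr 1; ring
    have h3 : pderiv true (c • ((X false : MvPolynomial Bool ℂ) ^ u false * X true ^ u true)) =
        (c * u true) • (X false ^ u false * X true ^ (u true - 1)) := by
      have : (X false : MvPolynomial Bool ℂ) ^ u false *
        ((u true : MvPolynomial Bool ℂ) * X true ^ (u true - 1)) =
          (u true : ℂ) • (X false ^ u false * X true ^ (u true - 1)) := by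
        rw [MvPolynomial.smul_eq_C_mul, map_natCast]; ring
      rw [Derivation.map_smul, Derivation.leibniz, pderiv_pow, pderiv_pow, mul_smul]
      simp [← this]
    rw [h2, h3, map_smul, map_smul, hL, hL, circularMoment, circularMoment]
    rcases u true with - | b
    · simp
    · by_cases hab : u false = b
      · simp [hab, Nat.factorial_succ, pow_succ]; ring
      · simp [hab]

/-- After integration by parts, the derivative falling on the first factor cancels the second term
of its recursion; only the derivative of the second factor survives. The indices of the second
factor are swapped because it stands for the conjugate of the polynomial of bidegree `(m', n')`. -/
theorem momentFunctional_herm_succ_mul_herm (r : ℂ) (L : MvPolynomial Bool ℂ →ₗ[ℂ] ℂ)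
    (hL : ∀ a b, L (X false ^ a * X true ^ b) = circularMoment r a b) (m n m' n' : ℕ) :
    L (hermPoly r (m + 1) n * hermPoly r n' m') =
      r * m' * L (hermPoly r m n * hermPoly r n' (m' - 1)) := by
    have h := momentFunctional_integration_by_parts r L hL (hermPoly r m n * hermPoly r n' m')
    rw [Derivation.leibniz, pderiv_true_hermPoly, pderiv_true_hermPoly] at h
    have h1 : hermPoly r (m + 1) n =
        X false * hermPoly r m n - C r * ((n : MvPolynomial Bool ℂ) * hermPoly r m (n - 1)) := by
      simp only [hermPoly, herm_succ_left]; ring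
    have h2 : hermPoly r m n • ((m' : MvPolynomial Bool ℂ) *
        hermPoly r n' (m' - 1)) =
        (m' : ℂ) • (hermPoly r m n * hermPoly r n' (m' - 1)) := by
      rw [MvPolynomial.smul_eq_C_mul, map_natCast, smul_eq_mul]; ring
    rw [h1, sub_mul, map_sub, mul_assoc, h, h2, mul_assoc (C r), ← MvPolynomial.smul_eq_C_mul,
      map_smul, map_add, map_smul, smul_eq_mul, smul_eq_mul, smul_eq_mul,
      mul_comm (hermPoly r n' m')]
    ring
theorem rename_not_hermPoly (r : ℂ) (m n : ℕ) :
    rename not (hermPoly r m n) = hermPoly r n m := by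
  rw [hermPoly, hermPoly, herm_swap, ← RingHom.coe_coe, map_herm]
  simp

theorem momentFunctional_herm_mul_herm (r : ℂ) (L : MvPolynomial Bool ℂ →ₗ[ℂ] ℂ)
    (hL : ∀ a b, L (X false ^ a * X true ^ b) = circularMoment r a b) (m n m' n' : ℕ) :
    L (hermPoly r m n * hermPoly r n' m') =
      if m = m' ∧ n = n' then m ! * n ! * r ^ (m + n) else 0 := by
  induction m generalizing m' with
  | zero =>
    rcases m' with - | m'
    · have h : hermPoly r 0 n * hermPoly r n' 0 =
          (X false : MvPolynomial Bool ℂ) ^ n' * X true ^ n := by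
        rw [hermPoly, hermPoly, herm_zero_left, herm_swap, herm_zero_left, mul_comm]
      rw [h, hL, circularMoment]
      by_cases hn : n = n'
      · simp [hn]
      · simp [hn, Ne.symm hn]
    · have hz : ∀ n', L (hermPoly r n' (m' + 1) * hermPoly r 0 n) = 0 := by
        intro n'
        -- Exchanging z and z̄ preserves the moments. The lowering relation for the exchanged
        -- functional lowers the index 0 and so produces the factor 0.
        have h := momentFunctional_herm_succ_mul_herm r (L.comp (rename not).toLinearMap)
          (fun a b => by
            have := hL b a
            rw [mul_comm] at this
            simp [this, circularMoment, eq_comm]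
            aesop) m' n' 0 n
        simpa [rename_not_hermPoly] using h
      rw [mul_comm, hz]; simp
  | succ m ih =>
    rw [momentFunctional_herm_succ_mul_herm r L hL, ih]
    rcases m' with - | m'
    · simp
    · by_cases h : m = m' ∧ n = n'
      · obtain ⟨rfl, rfl⟩ := h
        simp [Nat.factorial_succ]; ring
      · have h' : ¬ (m + 1 = m' + 1 ∧ n = n') := by omega
        rw [if_neg h', Nat.add_sub_cancel, if_neg h, mul_zero]

end MomentFunctional

end ComplexChaos

namespace ComplexChaos

/-! ### Random variables with moments of all orders -/

section MemAllLp

variable {Ω : Type*} [MeasurableSpace Ω] {P : Measure Ω}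

/-- The complex random variable `f` has finite moments of all orders. -/
def MemAllLp (f : Ω → ℂ) (P : Measure Ω) : Prop := ∀ p : ENNReal, p ≠ ⊤ → MemLp f p P

namespace MemAllLp

variable {f g : Ω → ℂ}

theorem memLp_two (hf : MemAllLp f P) : MemLp f 2 P := hf 2 (by simp)

theorem integrable (hf : MemAllLp f P) : Integrable f P := memLp_one_iff_integrable.1 (hf 1 (by simp))

theorem const [IsFiniteMeasure P] (c : ℂ) : MemAllLp (fun _ : Ω => c) P := fun _ _ => memLp_const c

theorem add (hf : MemAllLp f P) (hg : MemAllLp g P) : MemAllLp (fun ω => f ω + g ω) P :=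
  fun p hp => (hf p hp).add (hg p hp)

theorem sub (hf : MemAllLp f P) (hg : MemAllLp g P) : MemAllLp (fun ω => f ω - g ω) P :=
  fun p hp => (hf p hp).sub (hg p hp)

theorem const_mul (c : ℂ) (hf : MemAllLp f P) : MemAllLp (fun ω => c * f ω) P :=
  fun p hp => (hf p hp).const_mul c

theorem star (hf : MemAllLp f P) : MemAllLp (fun ω => conj (f ω)) P :=
  fun p hp => MeasureTheory.MemLp.star (hf p hp)

/-- Hölder's inequality with exponents 2p and 2p. This stability under products is why moments of
all orders are required rather than membership in L². -/
theorem mul (hf : MemAllLp f P) (hg : MemAllLp g P) : MemAllLp (fun ω => f ω * g ω) P := by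
  intro p hp
  have : ENNReal.HolderTriple (2 * p) (2 * p) p := ⟨by
    rw [ENNReal.mul_inv (by simp) (by simp), ← add_mul, ENNReal.inv_two_add_inv_two, one_mul]⟩
  exact (hg (2 * p) (ENNReal.mul_ne_top (by simp) hp)).mul
    (hf (2 * p) (ENNReal.mul_ne_top (by simp) hp))

theorem pow [IsFiniteMeasure P] (hf : MemAllLp f P) (n : ℕ) : MemAllLp (fun ω => f ω ^ n) P := by
  induction n with
  | zero => simpa using const 1
  | succ n ih => simpa only [pow_succ] using ih.mul hf

theorem prod [IsFiniteMeasure P] {κ : Type*} (s : Finset κ) {f : κ → Ω → ℂ}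
    (hf : ∀ k, MemAllLp (f k) P) : MemAllLp (fun ω => ∏ k ∈ s, f k ω) P := by
  classical
  induction s using Finset.induction_on with
  | empty => simpa using const 1
  | insert k s hk ih => simpa only [Finset.prod_insert hk] using (hf k).mul ih

theorem herm [IsFiniteMeasure P] (hf : MemAllLp f P) (hg : MemAllLp g P) (r : ℂ) (m n : ℕ) :
    MemAllLp (fun ω => herm r (f ω) (g ω) m n) P := by
  induction m generalizing n with
  | zero => simpa only [herm_zero_left] using hg.pow n
  | succ m ih =>
    simp only [herm_succ_left]
    exact (hf.mul (ih n)).sub ((ih (n - 1)).const_mul _)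

end MemAllLp

end MemAllLp

/-! ### Circular complex isonormal processes -/

section Circular

variable {Ω : Type*} [MeasurableSpace Ω] {P : Measure Ω}
  {K : Type*} [NormedAddCommGroup K] [InnerProductSpace ℂ K]

/-- A centered complex Gaussian family `Z` with `E[conj Z(g) Z(h)] = ⟪g, h⟫` and
`E[Z(g) Z(h)] = 0`. -/
structure IsCircularIsonormal (Z : K → Ω → ℂ) (P : Measure Ω) : Prop where
  isGaussianProcess : IsGaussianProcess Z P
  centered : ∀ h, ∫ ω, Z h ω ∂P = 0
  covariance : ∀ g h, ∫ ω, conj (Z g ω) * Z h ω ∂P = inner ℂ g h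
  pseudoCovariance : ∀ g h, ∫ ω, Z g ω * Z h ω ∂P = 0

namespace IsCircularIsonormal

variable {Z : K → Ω → ℂ} (hZ : IsCircularIsonormal Z P)
include hZ

theorem isProbabilityMeasure : IsProbabilityMeasure P := hZ.isGaussianProcess.isProbabilityMeasure

theorem memAllLp (h : K) : MemAllLp (Z h) P :=
  fun _ hp => (hZ.isGaussianProcess.hasGaussianLaw_eval h).memLp hp

theorem inner_toLp (g h : K) :
    inner ℂ (hZ.memAllLp g).memLp_two.toLp (hZ.memAllLp h).memLp_two.toLp = inner ℂ g h := by
  rw [L2.inner_def, ← hZ.covariance]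
  refine integral_congr_ae ?_
  filter_upwards [(hZ.memAllLp g).memLp_two.coeFn_toLp, (hZ.memAllLp h).memLp_two.coeFn_toLp]
    with ω h1 h2
  rw [h1, h2, RCLike.inner_apply, mul_comm]

/-- Additivity follows from the covariance alone: expanding the squared L² norm of Z(g + h) - Z(g) -
Z(h) gives zero. -/
theorem add_ae (g h : K) : Z (g + h) =ᵐ[P] fun ω => Z g ω + Z h ω := by
  set ζ : K → Lp ℂ 2 P := fun k => (hZ.memAllLp k).memLp_two.toLp
  have hi : ∀ g h, inner ℂ (ζ g) (ζ h) = inner ℂ g h := hZ.inner_toLp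
  have h0 : ζ (g + h) - (ζ g + ζ h) = 0 := by
    rw [← inner_self_eq_zero (𝕜 := ℂ)]
    simp only [inner_sub_left, inner_sub_right, inner_add_left, inner_add_right, hi]
    ring
  have h1 := sub_eq_zero.1 h0
  filter_upwards [(hZ.memAllLp (g + h)).memLp_two.coeFn_toLp, (hZ.memAllLp g).memLp_two.coeFn_toLp,
    (hZ.memAllLp h).memLp_two.coeFn_toLp, Lp.coeFn_add (ζ g) (ζ h)] with ω e1 e2 e3 e4
  rw [← e1, ← e2, ← e3]
  change (ζ (g + h)) ω = _
  rw [h1, e4]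
  rfl

theorem smul_ae (c : ℂ) (h : K) : Z (c • h) =ᵐ[P] fun ω => c * Z h ω := by
  set ζ : K → Lp ℂ 2 P := fun k => (hZ.memAllLp k).memLp_two.toLp
  have hi : ∀ g h, inner ℂ (ζ g) (ζ h) = inner ℂ g h := hZ.inner_toLp
  have h0 : ζ (c • h) - c • ζ h = 0 := by
    rw [← inner_self_eq_zero (𝕜 := ℂ)]
    simp only [inner_sub_left, inner_sub_right, inner_smul_left, inner_smul_right, hi]
    ring
  have h1 := sub_eq_zero.1 h0
  filter_upwards [(hZ.memAllLp (c • h)).memLp_two.coeFn_toLp, (hZ.memAllLp h).memLp_two.coeFn_toLp,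
    Lp.coeFn_smul c (ζ h)] with ω e1 e2 e3
  rw [← e1, ← e2]
  change (ζ (c • h)) ω = _
  rw [h1, e3]
  rfl

theorem zero_ae : Z 0 =ᵐ[P] fun _ => 0 := by
  have h := hZ.smul_ae 0 0
  simpa using h

/-- Gaussian independence is tested on real covariances of real linear functionals. By circularity
only the Hermitian covariance contributes. -/
theorem covariance_inner (x y : ℂ) (g h : K) :
    cov[fun ω => inner ℝ x (Z g ω), fun ω => inner ℝ y (Z h ω); P] =
      (conj x * y * inner ℂ h g).re / 2 := by
  have := hZ.isProbabilityMeasure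
  have hL : ∀ (x : ℂ) (g : K), ∫ ω, inner ℝ x (Z g ω) ∂P = 0 := by
    intro x g
    have := integral_inner (𝕜 := ℝ) (hZ.memAllLp g).integrable x
    rw [this, hZ.centered, inner_zero_right]
  have hM : ∀ (x : ℂ) (g : K), MemLp (fun ω => inner ℝ x (Z g ω)) 2 P := fun x g =>
    ((hZ.memAllLp g).memLp_two).const_inner x
  rw [covariance_eq_sub (hM x g) (hM y h), hL, hL]
  -- Re a · Re b = ½ Re(a b̄ + a b), with a = x̄ Z(g) and b = ȳ Z(h).
  have e : ∀ ω, (fun ω => inner ℝ x (Z g ω)) ω * (fun ω => inner ℝ y (Z h ω)) ω =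
      (conj x * y / 2 * (conj (Z h ω) * Z g ω) + conj x * conj y / 2 * (Z g ω * Z h ω)).re := by
    intro ω
    simp [Complex.inner]
    ring
  have i1 := (((hZ.memAllLp h).star.mul (hZ.memAllLp g)).const_mul (conj x * y / 2)).integrable
  have i2 := (((hZ.memAllLp g).mul (hZ.memAllLp h)).const_mul (conj x * conj y / 2)).integrable
  simp only [Pi.mul_apply, e]
  have h3 : ∀ {f : Ω → ℂ}, Integrable f P → ∫ ω, (f ω).re ∂P = (∫ ω, f ω ∂P).re :=
    fun hf => integral_re hf
  refine (congrArg (· - (0 : ℝ) * 0) (h3 (i1.add i2))).trans ?_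
  simp only [Pi.add_apply]
  rw [integral_add i1 i2, integral_const_mul, integral_const_mul,
    hZ.covariance, hZ.pseudoCovariance]
  simp
  ring

/-- Orthogonality makes all real covariances between different components vanish, which for a
jointly Gaussian family means independence. Each variable is viewed as a process indexed by `Unit`
to fit the criterion for families of processes. -/
theorem iIndepFun {κ : Type*} (h : κ → K) (hh : Pairwise fun j k => inner ℂ (h j) (h k) = 0) :
    iIndepFun (fun k => Z (h k)) P := by
  have hG : IsGaussianProcess (fun (p : (_ : κ) × Unit) ω => Z (h p.1) ω) P :=
    hZ.isGaussianProcess.comp_right fun p : (_ : κ) × Unit => h p.1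
  have h1 := IsGaussianProcess.iIndepFun_of_covariance_inner
    (S := fun _ : κ => Unit) (X := fun k (_ : Unit) => Z (h k)) hG
    (fun k _ => hZ.isGaussianProcess.aemeasurable _) (by
      intro j k hjk _ _ x y
      rw [hZ.covariance_inner, hh hjk.symm]
      simp)
  exact h1.comp (fun _ f => f ()) fun _ => measurable_pi_apply ()

theorem indepFun {g h : K} (hgh : inner ℂ g h = 0) : IndepFun (Z g) (Z h) P := by
  have h1 := hZ.iIndepFun (κ := Bool) (fun b => cond b g h) (by
    rintro (_ | _) (_ | _) hjk
    · exact absurd rfl hjk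
    · simpa using inner_eq_zero_symm.1 hgh
    · simpa using hgh
    · exact absurd rfl hjk)
  simpa using h1.indepFun (i := true) (j := false) (by simp)

/-- Real and imaginary parts are the functionals ⟪1, ·⟫ and ⟪i, ·⟫. By `covariance_inner` each has
variance 1/2 and their covariance is Re(i)/2 = 0, hence they are independent. -/
theorem map_eq_prod {h : K} (hh : ‖h‖ = 1) :
    P.map (fun ω => ((Z h ω).re, (Z h ω).im)) =
      (gaussianReal 0 (1 / 2)).prod (gaussianReal 0 (1 / 2)) := by
  have := hZ.isProbabilityMeasure
  have hG := hZ.isGaussianProcess.hasGaussianLaw_eval h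
  have e1 : (fun ω => (Z h ω).re) = fun ω => inner ℝ (1 : ℂ) (Z h ω) := by
    ext ω; simp [Complex.inner]
  have e2 : (fun ω => (Z h ω).im) = fun ω => inner ℝ Complex.I (Z h ω) := by
    ext ω; simp [Complex.inner]
  have hn : inner ℂ h h = 1 := by rw [inner_self_eq_norm_sq_to_K, hh]; simp
  have g1 : HasGaussianLaw (fun ω => (Z h ω).re) P := hG.map_fun Complex.reCLM
  have g2 : HasGaussianLaw (fun ω => (Z h ω).im) P := hG.map_fun Complex.imCLM
  have g3 : HasGaussianLaw (fun ω => ((Z h ω).re, (Z h ω).im)) P :=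
    hG.map_fun Complex.equivRealProdCLM.toContinuousLinearMap
  have hI : ∀ x : ℂ, ∫ ω, inner ℝ x (Z h ω) ∂P = 0 := by
    intro x
    have := integral_inner (𝕜 := ℝ) (hZ.memAllLp h).integrable x
    rw [this, hZ.centered, inner_zero_right]
  have hind := g3.indepFun_of_covariance_eq_zero (by
    rw [e1, e2, hZ.covariance_inner, hn]
    simp)
  rw [(indepFun_iff_map_prod_eq_prod_map_map g1.aemeasurable g2.aemeasurable).1 hind,
    g1.map_eq_gaussianReal, g2.map_eq_gaussianReal, ← covariance_self g1.aemeasurable,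
    ← covariance_self g2.aemeasurable, e1, e2, hI, hI, hZ.covariance_inner, hZ.covariance_inner, hn]
  have : Real.toNNReal 2⁻¹ = 1 / 2 := by
    ext; simp
  simp [this]

end IsCircularIsonormal

end Circular

/-! ### Moments of circular Gaussian variables -/

section Moments

/-- The product law has density π⁻¹ exp(-|z|²) on ℂ, and the integral of |z|^{2a} exp(-|z|²) is π
Γ(a + 1). -/
theorem integral_norm_pow_gaussian_prod (a : ℕ) :
    ∫ p : ℝ × ℝ, ‖(⟨p.1, p.2⟩ : ℂ)‖ ^ (2 * a)
      ∂((gaussianReal 0 (1 / 2)).prod (gaussianReal 0 (1 / 2))) = a ! := by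
  have h2 : (1 / 2 : NNReal) ≠ 0 := by simp
  rw [gaussianReal_of_var_ne_zero _ h2,
    prod_withDensity (measurable_gaussianPDF _ _) (measurable_gaussianPDF _ _),
    integral_withDensity_eq_integral_toReal_smul (by fun_prop) (by
      refine Filter.Eventually.of_forall fun p => ?_
      simp [gaussianPDF, ENNReal.mul_lt_top])]
  have hg : ∀ p : ℝ × ℝ, (gaussianPDF 0 (1 / 2) p.1 * gaussianPDF 0 (1 / 2) p.2).toReal •
      ‖(⟨p.1, p.2⟩ : ℂ)‖ ^ (2 * a) = (fun z : ℂ => Real.pi⁻¹ *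
        (‖z‖ ^ (2 * a : ℝ) * Real.exp (-‖z‖ ^ (2 : ℝ)))) (Complex.measurableEquivRealProd.symm p) := by
    intro p
    have hz : ‖(⟨p.1, p.2⟩ : ℂ)‖ ^ 2 = p.1 ^ 2 + p.2 ^ 2 := by
      rw [Complex.sq_norm, Complex.normSq_mk]; ring
    have h3 : ‖(⟨p.1, p.2⟩ : ℂ)‖ ^ (2 * a : ℝ) = ‖(⟨p.1, p.2⟩ : ℂ)‖ ^ (2 * a) := by
      rw [← Real.rpow_natCast]; push_cast; rfl
    rw [ENNReal.toReal_mul, toReal_gaussianPDF, toReal_gaussianPDF,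
      Complex.measurableEquivRealProd_symm_apply]
    simp only [h3, Real.rpow_two, hz, gaussianPDFReal, smul_eq_mul]
    have h4 : (√(2 * Real.pi * ((1 / 2 : NNReal) : ℝ)))⁻¹ * (√(2 * Real.pi * ((1 / 2 : NNReal) : ℝ)))⁻¹ =
        Real.pi⁻¹ := by
      rw [← mul_inv, Real.mul_self_sqrt (by positivity)]
      simp
      ring
    have h5 : Real.exp (-(p.1 - 0) ^ 2 / (2 * ((1 / 2 : NNReal) : ℝ))) *
        Real.exp (-(p.2 - 0) ^ 2 / (2 * ((1 / 2 : NNReal) : ℝ))) =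
          Real.exp (-(p.1 ^ 2 + p.2 ^ 2)) := by
      rw [← Real.exp_add]; congr 1; simp; ring
    rw [← h4, ← h5]
    ring
  rw [integral_congr_ae (Filter.Eventually.of_forall hg)]
  have := (Complex.volume_preserving_equiv_real_prod.symm
    Complex.measurableEquivRealProd).integral_comp' (fun z : ℂ => Real.pi⁻¹ *
        (‖z‖ ^ (2 * a : ℝ) * Real.exp (-‖z‖ ^ (2 : ℝ))))
  rw [← Measure.volume_eq_prod, this, integral_const_mul,
    Complex.integral_rpow_mul_exp_neg_rpow (by norm_num) (by
      have : (0 : ℝ) ≤ a := a.cast_nonneg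
      linarith)]
  have h6 : ((2 * a + 2 : ℝ)) / 2 = a + 1 := by ring
  rw [h6, Real.Gamma_nat_eq_factorial]
  field_simp

variable {Ω : Type*} [MeasurableSpace Ω] {P : Measure Ω}
  {K : Type*} [NormedAddCommGroup K] [InnerProductSpace ℂ K]

namespace IsCircularIsonormal

variable {Z : K → Ω → ℂ} (hZ : IsCircularIsonormal Z P)
include hZ

theorem integral_comp_eq {h k : K} (hh : ‖h‖ = 1) (hk : ‖k‖ = 1) {f : ℂ → ℂ} (hf : Continuous f) :
    ∫ ω, f (Z h ω) ∂P = ∫ ω, f (Z k ω) ∂P := by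
  have h1 : ∀ {h : K}, ‖h‖ = 1 → ∫ ω, f (Z h ω) ∂P = ∫ p : ℝ × ℝ, f ⟨p.1, p.2⟩
      ∂((gaussianReal 0 (1 / 2)).prod (gaussianReal 0 (1 / 2))) := by
    intro h hh
    have hc : Continuous fun p : ℝ × ℝ => f ⟨p.1, p.2⟩ :=
      hf.comp Complex.equivRealProdCLM.symm.continuous
    rw [← hZ.map_eq_prod hh, integral_map _ hc.aestronglyMeasurable]
    have := hZ.isGaussianProcess.aemeasurable h
    fun_prop
  rw [h1 hh, h1 hk]

theorem integral_pow_mul_conj_pow_of_norm_eq_one {h : K} (hh : ‖h‖ = 1) (a b : ℕ) :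
    ∫ ω, Z h ω ^ a * conj (Z h ω) ^ b ∂P = circularMoment 1 a b := by
  rw [circularMoment]
  split_ifs with hab
  · subst hab
    have e : ∀ ω, Z h ω ^ a * conj (Z h ω) ^ a = ((‖Z h ω‖ ^ (2 * a) : ℝ) : ℂ) := by
      intro ω
      rw [← mul_pow, Complex.mul_conj, Complex.normSq_eq_norm_sq, ← Complex.ofReal_pow, pow_mul]
    simp only [e]
    rw [integral_complex_ofReal, one_pow, mul_one]
    have hc : Continuous fun p : ℝ × ℝ => ‖(⟨p.1, p.2⟩ : ℂ)‖ ^ (2 * a) := by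
      have : Continuous fun p : ℝ × ℝ => (⟨p.1, p.2⟩ : ℂ) :=
        Complex.equivRealProdCLM.symm.continuous
      fun_prop
    have := integral_norm_pow_gaussian_prod a
    rw [← hZ.map_eq_prod hh, integral_map _ hc.aestronglyMeasurable] at this
    · exact_mod_cast this
    · have := hZ.isGaussianProcess.aemeasurable h
      fun_prop
  -- The unit `u` is chosen with u^{a-b} = -1. Since Z(uh) and Z(h) have the same law, the mixed
  -- moment equals its own negative.
  · set u : ℂ := Complex.exp (Real.pi / ((a : ℂ) - b) * Complex.I) with hu
    have hab' : (a : ℂ) - b ≠ 0 := by rw [sub_ne_zero]; exact_mod_cast hab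
    have hu1 : ‖u‖ = 1 := by
      have : (Real.pi / ((a : ℂ) - b) : ℂ) = ((Real.pi / ((a : ℝ) - b) : ℝ) : ℂ) := by
        push_cast; rfl
      rw [hu, this, Complex.norm_exp_ofReal_mul_I]
    have hu2 : u ^ a * conj u ^ b = -1 := by
      have hc : conj u = Complex.exp (-(Real.pi / ((a : ℂ) - b) * Complex.I)) := by
        rw [hu, ← Complex.exp_conj]; simp
      rw [hc, hu, ← Complex.exp_nat_mul, ← Complex.exp_nat_mul, ← Complex.exp_add,
        ← Complex.exp_pi_mul_I]
      congr 1
      field_simp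
      ring
    have h1 := hZ.integral_comp_eq (h := u • h) (k := h) (by rw [norm_smul, hu1, hh, one_mul]) hh
      (f := fun z => z ^ a * conj z ^ b) (by fun_prop)
    have h2 : ∫ ω, Z (u • h) ω ^ a * conj (Z (u • h) ω) ^ b ∂P =
        ∫ ω, -(Z h ω ^ a * conj (Z h ω) ^ b) ∂P := by
      refine integral_congr_ae ?_
      filter_upwards [hZ.smul_ae u h] with ω e
      rw [e, map_mul, mul_pow, mul_pow, mul_mul_mul_comm, hu2, neg_one_mul]
    rw [h2, integral_neg] at h1
    exact self_eq_neg.1 h1.symm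

theorem integral_pow_mul_conj_pow (h : K) (a b : ℕ) :
    ∫ ω, Z h ω ^ a * conj (Z h ω) ^ b ∂P = circularMoment ((‖h‖ : ℂ) ^ 2) a b := by
  have := hZ.isProbabilityMeasure
  by_cases hh : h = 0
  · subst hh
    rw [integral_congr_ae (g := fun _ => (0 : ℂ) ^ a * 0 ^ b)]
    · rcases a with - | a <;> rcases b with - | b <;> simp [circularMoment]
    · filter_upwards [hZ.zero_ae] with ω e
      rw [e, map_zero]
  · have hn : ‖h‖ ≠ 0 := norm_ne_zero_iff.2 hh
    set k : K := ((‖h‖ : ℂ)⁻¹) • h with hk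
    have hk1 : ‖k‖ = 1 := by
      rw [hk, norm_smul]; simp [hn]
    have hk2 : h = (‖h‖ : ℂ) • k := by
      rw [hk, smul_smul, mul_inv_cancel₀ (by exact_mod_cast hn), one_smul]
    rw [integral_congr_ae (g := fun ω => (‖h‖ : ℂ) ^ (a + b) * (Z k ω ^ a * conj (Z k ω) ^ b)),
      integral_const_mul, hZ.integral_pow_mul_conj_pow_of_norm_eq_one hk1]
    · rw [circularMoment, circularMoment]
      split_ifs with hab
      · subst hab; ring
      · simp
    · have e' := hZ.smul_ae (‖h‖ : ℂ) k
      rw [← hk2] at e'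
      filter_upwards [e'] with ω e
      rw [e, map_mul, Complex.conj_ofReal]
      ring

open MvPolynomial in
/-- Orthogonality of the complex Hermite polynomials of one circular Gaussian variable. -/
theorem integral_conj_herm_mul_herm (h : K) (m n m' n' : ℕ) :
    ∫ ω, conj (herm ((‖h‖ : ℂ) ^ 2) (Z h ω) (conj (Z h ω)) m' n') *
      herm ((‖h‖ : ℂ) ^ 2) (Z h ω) (conj (Z h ω)) m n ∂P =
        if m = m' ∧ n = n' then (m ! * n ! * ((‖h‖ : ℂ) ^ 2) ^ (m + n) : ℂ) else 0 := by
  have := hZ.isProbabilityMeasure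
  have hint : ∀ p : MvPolynomial Bool ℂ,
      MemAllLp (fun ω => aeval (fun b => cond b (conj (Z h ω)) (Z h ω)) p) P := by
    intro p
    induction p using MvPolynomial.induction_on with
    | C c => simpa using MemAllLp.const c
    | add p q hp hq => simpa using hp.add hq
    | mul_X p b hp =>
      cases b
      · simpa using hp.mul (hZ.memAllLp h)
      · simpa using hp.mul (hZ.memAllLp h).star
  -- The expectation of a polynomial in Z(h) and its conjugate, where `false` stands for z and
  -- `true` for z̄.
  let L : MvPolynomial Bool ℂ →ₗ[ℂ] ℂ :=
    { toFun p := ∫ ω, aeval (fun b => cond b (conj (Z h ω)) (Z h ω)) p ∂P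
      map_add' p q := by
        simp only [map_add]
        exact integral_add (hint p).integrable (hint q).integrable
      map_smul' c p := by
        simp only [map_smul, smul_eq_mul, RingHom.id_apply]
        exact integral_const_mul _ _ }
  have hL := momentFunctional_herm_mul_herm ((‖h‖ : ℂ) ^ 2) L (fun a b => by
    simpa [L] using hZ.integral_pow_mul_conj_pow h a b) m n m' n'
  rw [← hL]
  refine integral_congr_ae (Filter.Eventually.of_forall fun ω => ?_)
  have e : ∀ m n, aeval (fun b => cond b (conj (Z h ω)) (Z h ω)) (hermPoly ((‖h‖ : ℂ) ^ 2) m n) =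
      herm ((‖h‖ : ℂ) ^ 2) (Z h ω) (conj (Z h ω)) m n := by
    intro m n
    rw [hermPoly, ← RingHom.coe_coe, map_herm]
    simp
  have hc := conj_herm (‖h‖ ^ 2) (Z h ω) m' n'
  push_cast at hc
  simp only [map_mul, e, hc]
  ring

end IsCircularIsonormal

end Moments

end ComplexChaos

namespace ComplexChaos

/-! ### The process `Z` built from two independent real isonormal processes -/

section ComplexIsonormal

variable {Ω : Type*} [MeasurableSpace Ω] {P : Measure Ω}

theorem integral_linearCombination_mul {κ : Type*} [Fintype κ] (a b : κ → ℂ) {U V : κ → Ω → ℝ}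
    (hU : ∀ i, MemLp (U i) 2 P) (hV : ∀ i, MemLp (V i) 2 P) :
    ∫ ω, (∑ i, a i * U i ω) * (∑ j, b j * V j ω) ∂P =
      ∑ i, ∑ j, a i * b j * ((∫ ω, U i ω * V j ω ∂P : ℝ) : ℂ) := by
  have hi : ∀ i j, Integrable (fun ω => a i * b j * ((U i ω * V j ω : ℝ) : ℂ)) P := fun i j =>
    ((hU i).integrable_mul (hV j)).ofReal.const_mul _
  have e : ∀ ω, (∑ i, a i * U i ω) * (∑ j, b j * V j ω) =
      ∑ i, ∑ j, a i * b j * ((U i ω * V j ω : ℝ) : ℂ) := by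
    intro ω
    rw [Finset.sum_mul_sum]
    refine Finset.sum_congr rfl fun i _ => Finset.sum_congr rfl fun j _ => ?_
    push_cast; ring
  simp only [e]
  rw [integral_finsetSum _ fun i _ => integrable_finsetSum _ fun j _ => hi i j]
  refine Finset.sum_congr rfl fun i _ => ?_
  rw [integral_finsetSum _ fun j _ => hi i j]
  refine Finset.sum_congr rfl fun j _ => ?_
  rw [integral_const_mul, integral_complex_ofReal]

variable {H : Type*} [NormedAddCommGroup H] [InnerProductSpace ℝ H] {X Y : H → Ω → ℝ}

theorem isGaussianProcess_complexIsonormal (hX : IsGaussianProcess X P) (hY : IsGaussianProcess Y P)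
    (hXY : IndepFun (fun ω h => X h ω) (fun ω h => Y h ω) P) :
    IsGaussianProcess (complexIsonormal X Y) P := by
  classical
  constructor
  intro I
  -- `J` collects all real and imaginary parts of the vectors in `I`. On `I` the process `Z` is then
  -- a linear image of the independent Gaussian vectors X|_J and Y|_J.
  set J : Finset H := I.image Complexification.re ∪ I.image Complexification.im with hJ
  have hre : ∀ i : I, i.1.re ∈ J := fun i =>
    Finset.mem_union_left _ (Finset.mem_image_of_mem _ i.2)
  have him : ∀ i : I, i.1.im ∈ J := fun i =>
    Finset.mem_union_right _ (Finset.mem_image_of_mem _ i.2)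
  have hind : IndepFun (fun ω => J.restrict (X · ω)) (fun ω => J.restrict (Y · ω)) P :=
    hXY.comp (Finset.measurable_restrict J) (Finset.measurable_restrict J)
  have hG := IndepFun.hasGaussianLaw (hX.hasGaussianLaw J) (hY.hasGaussianLaw J) hind
  let L : ((J → ℝ) × (J → ℝ)) →ₗ[ℝ] (I → ℂ) :=
    { toFun p i := ((p.1 ⟨_, hre i⟩ + Complex.I * p.1 ⟨_, him i⟩) +
        Complex.I * (p.2 ⟨_, hre i⟩ + Complex.I * p.2 ⟨_, him i⟩)) / (√2 : ℝ)
      map_add' p q := by ext i; simp; ring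
      map_smul' c p := by ext i; simp; ring }
  exact hG.map_fun L.toContinuousLinearMap

theorem IsIsonormal.memLp_two (hX : IsIsonormal X P) (h : H) : MemLp (X h) 2 P :=
  (hX.isGaussianProcess.hasGaussianLaw_eval h).memLp_two

theorem complexIsonormal_eq_sum (h : Complexification H) (ω : Ω) :
    complexIsonormal X Y h ω = ∑ i : Fin 4,
      ![1 / ((√2 : ℝ) : ℂ), Complex.I / ((√2 : ℝ) : ℂ), Complex.I / ((√2 : ℝ) : ℂ),
        -1 / ((√2 : ℝ) : ℂ)] i * (![X h.re, X h.im, Y h.re, Y h.im] i ω : ℂ) := by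
  simp only [complexIsonormal, complexify, Fin.sum_univ_four]
  simp
  ring_nf
  simp
  ring

theorem conj_complexIsonormal_eq_sum (h : Complexification H) (ω : Ω) :
    conj (complexIsonormal X Y h ω) = ∑ i : Fin 4,
      ![1 / ((√2 : ℝ) : ℂ), -Complex.I / ((√2 : ℝ) : ℂ), -Complex.I / ((√2 : ℝ) : ℂ),
        -1 / ((√2 : ℝ) : ℂ)] i * (![X h.re, X h.im, Y h.re, Y h.im] i ω : ℂ) := by
  rw [complexIsonormal_eq_sum]
  simp [Fin.sum_univ_four, Complex.conj_ofReal]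

/-- The mixed terms in X and Y vanish by independence. The X and Y contributions are equal in E[conj
Z(g) Z(h)], where the factor 1/2 averages them, and opposite in E[Z(g) Z(h)], because i² = -1. -/
theorem isCircularIsonormal_complexIsonormal [IsProbabilityMeasure P]
    (hX : IsIsonormal X P) (hY : IsIsonormal Y P)
    (hXY : IndepFun (fun ω h => X h ω) (fun ω h => Y h ω) P) :
    IsCircularIsonormal (complexIsonormal X Y) P := by
  have hxy : ∀ g h, ∫ ω, X g ω * Y h ω ∂P = 0 := by
    intro g h
    have : IndepFun (X g) (Y h) P :=
      hXY.comp (measurable_pi_apply g) (measurable_pi_apply h)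
    rw [this.integral_fun_mul_eq_mul_integral (hX.memLp_two g).aestronglyMeasurable
      (hY.memLp_two h).aestronglyMeasurable, hX.centered, zero_mul]
  have hyx : ∀ g h, ∫ ω, Y g ω * X h ω ∂P = 0 := by
    intro g h
    simp_rw [mul_comm (Y g _)]
    exact hxy h g
  have hL : ∀ (h : Complexification H) i, MemLp (![X h.re, X h.im, Y h.re, Y h.im] i) 2 P := by
    intro h i
    fin_cases i
    exacts [hX.memLp_two _, hX.memLp_two _, hY.memLp_two _, hY.memLp_two _]
  have hs : (((√2 : ℝ) : ℂ))⁻¹ * (((√2 : ℝ) : ℂ))⁻¹ = 1 / 2 := by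
    rw [← mul_inv, ← Complex.ofReal_mul, Real.mul_self_sqrt (by norm_num)]
    norm_num
  refine ⟨isGaussianProcess_complexIsonormal hX.isGaussianProcess hY.isGaussianProcess hXY,
    fun h => ?_, fun g h => ?_, fun g h => ?_⟩
  · simp only [complexIsonormal_eq_sum]
    rw [integral_finsetSum _ fun i _ =>
      (((hL h i).integrable (by norm_num)).ofReal.const_mul _)]
    refine Finset.sum_eq_zero fun i _ => ?_
    rw [integral_const_mul, integral_complex_ofReal]
    fin_cases i <;> simp [hX.centered, hY.centered]
  · simp only [conj_complexIsonormal_eq_sum]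
    simp only [complexIsonormal_eq_sum]
    rw [integral_linearCombination_mul _ _ (hL g) (hL h)]
    have hi : inner ℂ g h = (⟨inner ℝ g.re h.re + inner ℝ g.im h.im,
      inner ℝ g.re h.im - inner ℝ g.im h.re⟩ : ℂ) := rfl
    simp only [Fin.sum_univ_four]
    simp [hX.covariance, hY.covariance, hxy, hyx, hi]
    simp only [div_eq_mul_inv]
    generalize (((√2 : ℝ) : ℂ))⁻¹ = s at hs
    have e : ∀ a b : ℝ, (⟨a, b⟩ : ℂ) = a + b * Complex.I := Complex.mk_eq_add_mul_I
    rw [e]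
    push_cast
    have hI := Complex.I_mul_I
    linear_combination (2 * ((inner ℝ g.re h.re : ℝ) + (inner ℝ g.im h.im : ℝ)) +
      2 * Complex.I * ((inner ℝ g.re h.im : ℝ) - (inner ℝ g.im h.re : ℝ))) * hs -
      s * s * ((inner ℝ g.re h.re : ℝ) + (inner ℝ g.im h.im : ℝ)) * hI
  · simp only [complexIsonormal_eq_sum]
    rw [integral_linearCombination_mul _ _ (hL g) (hL h)]
    simp only [Fin.sum_univ_four]
    simp [hX.covariance, hY.covariance, hxy, hyx]
    simp only [div_eq_mul_inv]
    generalize (((√2 : ℝ) : ℂ))⁻¹ = s at hs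
    have hI := Complex.I_mul_I
    linear_combination s * s * ((inner ℝ g.re h.re : ℝ) + (inner ℝ g.im h.im : ℝ)) * hI

end ComplexIsonormal

end ComplexChaos

namespace ComplexChaos

/-! ### Multi-indices of lists -/

section MultiIndex

variable {ι : Type*} {m : ℕ}

theorem multiIndex_apply [DecidableEq ι] (a : Fin m → ι) (k : ι) :
    multiIndex a k = Fintype.card {j // a j = k} := by
  rw [multiIndex, Finsupp.finsetSum_apply, Fintype.card_subtype, Finset.card_filter]
  simp [Finsupp.single_apply]

theorem degree_multiIndex (a : Fin m → ι) : (multiIndex a).degree = m := by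
  simp [multiIndex]

theorem multiIndex_comp_perm (a : Fin m → ι) (σ : Equiv.Perm (Fin m)) :
    multiIndex (fun j => a (σ j)) = multiIndex a :=
  Equiv.sum_comp σ fun j => Finsupp.single (a j) 1

/-- The fibres of the two lists over each index have equal cardinality; bijections between them glue
to a permutation. -/
theorem exists_perm_of_multiIndex_eq {a b : Fin m → ι} (h : multiIndex a = multiIndex b) :
    ∃ σ : Equiv.Perm (Fin m), ∀ j, b (σ j) = a j := by
  classical
  have hk : ∀ k, Nonempty ({j // a j = k} ≃ {j // b j = k}) := fun k => by
    have hk := DFunLike.congr_fun h k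
    rw [multiIndex_apply, multiIndex_apply] at hk
    exact Fintype.card_eq.1 hk
  let F : ∀ k, {j // a j = k} ≃ {j // b j = k} := fun k => (hk k).some
  refine ⟨(Equiv.sigmaFiberEquiv a).symm.trans
    ((Equiv.sigmaCongrRight F).trans (Equiv.sigmaFiberEquiv b)), fun j => ?_⟩
  exact (F (a j) ⟨j, rfl⟩).2

theorem exists_multiIndex_eq (μ : ι →₀ ℕ) : ∃ a : Fin μ.degree → ι, multiIndex a = μ := by
  classical
  have hl : μ.toMultiset.toList.length = μ.degree := by
    rw [Multiset.length_toList, Finsupp.card_toMultiset]; rfl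
  refine ⟨fun j => μ.toMultiset.toList.get (Fin.cast hl.symm j), ?_⟩
  refine (Multiset.toFinsupp (α := ι)).symm.injective ?_
  change Finsupp.toMultiset _ = Finsupp.toMultiset _
  rw [multiIndex, map_sum]
  simp only [Finsupp.toMultiset_single, one_smul]
  refine (Fintype.sum_equiv (finCongr hl.symm) _
    (fun j => ({μ.toMultiset.toList.get j} : Multiset ι)) (fun j => rfl)).trans ?_
  conv_rhs => rw [← Multiset.coe_toList (Finsupp.toMultiset μ)]
  generalize (Finsupp.toMultiset μ).toList = l
  induction l with
  | nil => simp
  | cons x l ih =>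
    rw [← Multiset.cons_coe, ← ih]
    exact Fin.sum_univ_succ _

/-- A permutation fixing the list `a` permutes each fibre separately, so the stabilizer is a product
of symmetric groups. -/
theorem card_stabilizer_eq_multiFactorial [DecidableEq ι] (a : Fin m → ι) :
    (Finset.univ.filter fun σ : Equiv.Perm (Fin m) => ∀ j, a (σ j) = a j).card =
      multiFactorial (multiIndex a) := by
  classical
  have h := DomMulAct.stabilizer_card' (f := a)
  rw [Fintype.card_subtype] at h
  have h1 : (Finset.univ.filter fun σ : Equiv.Perm (Fin m) => ∀ j, a (σ j) = a j) =
      Finset.univ.filter fun σ : Equiv.Perm (Fin m) => a ∘ σ = a := by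
    ext σ; simp [funext_iff]
  rw [h1, h, multiFactorial, Finsupp.prod]
  refine (Finset.prod_subset_one_on_sdiff ?_ ?_ ?_).symm
  · intro k hk
    rw [Finsupp.mem_support_iff, multiIndex_apply] at hk
    obtain ⟨⟨j, hj⟩⟩ := Fintype.card_pos_iff.1 (Nat.pos_of_ne_zero hk)
    exact Finset.mem_image.2 ⟨j, Finset.mem_univ _, hj⟩
  · intro k hk
    have : multiIndex a k = 0 := Finsupp.notMem_support_iff.1 (Finset.mem_sdiff.1 hk).2
    rw [multiIndex_apply] at this
    simp [this]
  · intro k _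
    rw [multiIndex_apply]

end MultiIndex

/-! ### Symmetric tensors of orthonormal families -/

section Tensors

variable {K : Type*} [NormedAddCommGroup K] [InnerProductSpace ℂ K] {m n : ℕ}

namespace PreTensor

/-- Of the two sums over permutations one is redundant: right translation makes its m! terms equal,
which cancels one factor 1/m!. -/
theorem inner_symm_pure (v w : Fin m → K) :
    inner ℂ (symm (pure v)) (symm (pure w)) =
      (m ! : ℂ)⁻¹ * ∑ σ : Equiv.Perm (Fin m), ∏ i, inner ℂ (v i) (w (σ i)) := by
  have hm : (m ! : ℂ) ≠ 0 := by exact_mod_cast m.factorial_ne_zero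
  rw [symm_pure, symm_pure, inner_smul_left, inner_smul_right, sum_inner]
  simp only [inner_sum, inner_pure]
  have h : ∀ σ : Equiv.Perm (Fin m), ∑ τ : Equiv.Perm (Fin m), ∏ i, inner ℂ (v (σ i)) (w (τ i)) =
      ∑ τ : Equiv.Perm (Fin m), ∏ i, inner ℂ (v i) (w (τ i)) := by
    intro σ
    rw [← Equiv.sum_comp (Equiv.mulRight σ)]
    refine Finset.sum_congr rfl fun τ _ => ?_
    exact Equiv.prod_comp σ fun i => inner ℂ (v i) (w (τ i))
  simp only [h, Finset.sum_const, Finset.card_univ, Fintype.card_perm, Fintype.card_fin,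
    nsmul_eq_mul, map_inv₀, Complex.conj_natCast]
  field_simp

/-- The tensor product `K^{⊗m} × K^{⊗n} → K^{⊗(m+n)}` as a bilinear map. -/
def tmulₗ (m n : ℕ) (K : Type*) [NormedAddCommGroup K] [InnerProductSpace ℂ K] :
    PreTensor (Fin m) K →ₗ[ℂ] PreTensor (Fin n) K →ₗ[ℂ] PreTensor (Fin m ⊕ Fin n) K :=
  show (⨂[ℂ] _ : Fin m, K) →ₗ[ℂ] (⨂[ℂ] _ : Fin n, K) →ₗ[ℂ] (⨂[ℂ] _ : Fin m ⊕ Fin n, K) from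
    (TensorProduct.mk ℂ (⨂[ℂ] _ : Fin m, K) (⨂[ℂ] _ : Fin n, K)).compr₂
      (PiTensorProduct.tmulEquiv ℂ K).toLinearMap

theorem tmul_eq (a : PreTensor (Fin m) K) (b : PreTensor (Fin n) K) : tmul a b = tmulₗ m n K a b :=
  rfl

theorem induction_pure {κ : Type*} {Q : PreTensor κ K → Prop}
    (smul : ∀ (r : ℂ) (v : κ → K), Q (r • pure v)) (add : ∀ x y, Q x → Q y → Q (x + y))
    (x : PreTensor κ K) : Q x :=
  PiTensorProduct.induction_on (motive := Q) x smul add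

theorem inner_tmul (a c : PreTensor (Fin m) K) (b d : PreTensor (Fin n) K) :
    inner ℂ (tmul a b) (tmul c d) = inner ℂ a c * inner ℂ b d := by
  induction a using induction_pure with
  | add x y hx hy =>
    rw [tmul_eq, map_add, LinearMap.add_apply, inner_add_left, ← tmul_eq, ← tmul_eq, hx, hy,
      inner_add_left, add_mul]
  | smul r v =>
  induction c using induction_pure with
  | add x y hx hy =>
    rw [tmul_eq (x + y), map_add, LinearMap.add_apply, inner_add_right, ← tmul_eq, ← tmul_eq, hx, hy,
      inner_add_right, add_mul]
  | smul s w =>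
  induction b using induction_pure with
  | add x y hx hy =>
    rw [tmul_eq, map_add, inner_add_left, ← tmul_eq, ← tmul_eq, hx, hy,
      inner_add_left, mul_add]
  | smul r' v' =>
  induction d using induction_pure with
  | add x y hx hy =>
    rw [tmul_eq (s • pure w), map_add, inner_add_right, ← tmul_eq, ← tmul_eq, hx, hy,
      inner_add_right, mul_add]
  | smul s' w' =>
    simp only [tmul_eq, map_smul, LinearMap.smul_apply]
    simp only [← tmul_eq, inner_smul_left, inner_smul_right, tmul_pure, inner_pure,
      Fintype.prod_sum_type, Sum.elim_inl, Sum.elim_inr]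
    ring

end PreTensor

theorem inner_symmTensor (v v' : Fin m → K) (w w' : Fin n → K) :
    inner ℂ (symmTensor v w) (symmTensor v' w') =
      ((m ! : ℂ)⁻¹ * ∑ σ : Equiv.Perm (Fin m), ∏ i, inner ℂ (v i) (v' (σ i))) *
        ((n ! : ℂ)⁻¹ * ∑ σ : Equiv.Perm (Fin n), ∏ i, inner ℂ (w i) (w' (σ i))) := by
  rw [symmTensor, symmTensor, LinearIsometry.inner_map_map, PreTensor.inner_tmul,
    PreTensor.inner_symm_pure, PreTensor.inner_symm_pure]

theorem PreTensor.symm_pure_comp_perm (v : Fin m → K) (σ : Equiv.Perm (Fin m)) :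
    symm (pure fun j => v (σ j)) = symm (pure v) := by
  rw [symm_pure, symm_pure]
  congr 1
  exact Equiv.sum_comp (Equiv.mulLeft σ) fun τ => pure fun i => v (τ i)

variable {ι : Type*}

/-- A nonzero summand would force `a = b ∘ σ`, hence equal multi-indices. -/
theorem sum_perm_prod_inner_eq_zero {u : ι → K} (hu : Orthonormal ℂ u) {a b : Fin m → ι}
    (hab : multiIndex a ≠ multiIndex b) :
    ∑ σ : Equiv.Perm (Fin m), ∏ i, inner ℂ (u (a i)) (u (b (σ i))) = 0 := by
  refine Finset.sum_eq_zero fun σ _ => ?_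
  by_contra hne
  refine hab ?_
  rw [← multiIndex_comp_perm b σ]
  congr 1
  ext i
  by_contra hi
  exact hne (Finset.prod_eq_zero (Finset.mem_univ i) (hu.2 hi))

/-- A summand is 1 when `σ` fixes the list `a` and 0 otherwise, so the sum counts the stabilizer. -/
theorem sum_perm_prod_inner_self {u : ι → K} (hu : Orthonormal ℂ u) (a : Fin m → ι) :
    ∑ σ : Equiv.Perm (Fin m), ∏ i, inner ℂ (u (a i)) (u (a (σ i))) =
      multiFactorial (multiIndex a) := by
  classical
  rw [← card_stabilizer_eq_multiFactorial, Finset.card_filter]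
  push_cast
  refine Finset.sum_congr rfl fun σ _ => ?_
  have hu' := orthonormal_iff_ite.1 hu
  split_ifs with h
  · exact Finset.prod_eq_one fun i _ => by rw [h, hu', if_pos rfl]
  · obtain ⟨i, hi⟩ := not_forall.1 h
    exact Finset.prod_eq_zero (Finset.mem_univ i) (by rw [hu', if_neg (Ne.symm hi)])

theorem multiFactorial_pos (μ : ι →₀ ℕ) : 0 < multiFactorial μ :=
  Finset.prod_pos fun _ _ => Nat.factorial_pos _

/-! ### Density of the tensors of basis vectors -/

/-- The slots are freed one at a time: with the others fixed, the vectors admissible in slot `i`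
form a closed subspace containing the total family `b i`. -/
theorem ContinuousMultilinearMap.mem_of_forall_basis_mem {κ : Type*} [Fintype κ] {E : Type*}
    [NormedAddCommGroup E] [NormedSpace ℂ E]
    (M : ContinuousMultilinearMap ℂ (fun _ : κ => K) E) (C : Submodule ℂ E)
    (hC : IsClosed (C : Set E)) (b : κ → ι → K)
    (hb : ∀ i, (Submodule.span ℂ (Set.range (b i))).topologicalClosure = ⊤)
    (h : ∀ a : κ → ι, M (fun i => b i (a i)) ∈ C) (u : κ → K) : M u ∈ C := by
  classical
  suffices hs : ∀ (s : Finset κ) (u : κ → K), (∀ i ∉ s, u i ∈ Set.range (b i)) → M u ∈ C from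
    hs Finset.univ u (by simp)
  intro s
  induction s using Finset.induction_on with
  | empty =>
    intro u hu
    choose a ha using fun i => hu i (by simp)
    have : u = fun i => b i (a i) := funext fun i => (ha i).symm
    rw [this]
    exact h a
  | insert i s hi ih =>
    intro u hu
    let D : Submodule ℂ K := C.comap (M.toContinuousLinearMap u i).toLinearMap
    have hD : IsClosed (D : Set K) := hC.preimage (M.toContinuousLinearMap u i).continuous
    have hsub : Submodule.span ℂ (Set.range (b i)) ≤ D := by
      rw [Submodule.span_le]
      rintro _ ⟨k, rfl⟩
      refine ih (Function.update u i (b i k)) fun j hj => ?_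
      by_cases hji : j = i
      · subst hji; simp
      · rw [Function.update_of_ne hji]
        exact hu j (by simp [hji, hj])
    have htop : D = ⊤ := top_le_iff.1 ((hb i).symm.le.trans
      (Submodule.topologicalClosure_minimal _ hsub hD))
    have : u i ∈ D := htop ▸ Submodule.mem_top
    simpa [D] using this

/-- The elementary tensor as a continuous multilinear map into the Hilbert space tensor power. -/
def pureCMM (κ K : Type*) [Fintype κ] [NormedAddCommGroup K] [InnerProductSpace ℂ K] :
    ContinuousMultilinearMap ℂ (fun _ : κ => K) (HilbertTensor κ K) :=
  ((HilbertTensor.of (κ := κ) (K := K)).toLinearMap.compMultilinearMap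
    (PiTensorProduct.tprod ℂ : MultilinearMap ℂ (fun _ : κ => K) (⨂[ℂ] _ : κ, K))).mkContinuous 1
    (by
      intro v
      have h : ‖HilbertTensor.of (PreTensor.pure v)‖ = ∏ i, ‖v i‖ := by
        rw [LinearIsometry.norm_map, ← sq_eq_sq₀ (norm_nonneg _)
          (Finset.prod_nonneg fun _ _ => norm_nonneg _)]
        have h := inner_self_eq_norm_sq_to_K (𝕜 := ℂ) (PreTensor.pure v)
        rw [PreTensor.inner_pure] at h
        simp only [inner_self_eq_norm_sq_to_K] at h
        rw [← Finset.prod_pow]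
        exact_mod_cast h.symm
      rw [one_mul]
      exact h.le)

theorem pureCMM_apply {κ : Type*} [Fintype κ] (v : κ → K) :
    pureCMM κ K v = HilbertTensor.of (PreTensor.pure v) := rfl

/-- The map `(v, w) ↦ symm(⊗ vᵢ) ⊗ symm(⊗ wⱼ)` as a continuous multilinear map. -/
def symmTensorCMM (K : Type*) [NormedAddCommGroup K] [InnerProductSpace ℂ K] (m n : ℕ) :
    ContinuousMultilinearMap ℂ (fun _ : Fin m ⊕ Fin n => K) (HilbertTensor (Fin m ⊕ Fin n) K) :=
  ∑ τ : Equiv.Perm (Fin n), (n ! : ℂ)⁻¹ • (m ! : ℂ)⁻¹ • ∑ σ : Equiv.Perm (Fin m),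
    (pureCMM (Fin m ⊕ Fin n) K).domDomCongr (Equiv.sumCongr σ τ)

theorem symmTensorCMM_apply (u : Fin m ⊕ Fin n → K) :
    symmTensorCMM K m n u = symmTensor (fun i => u (Sum.inl i)) (fun j => u (Sum.inr j)) := by
  rw [symmTensor, PreTensor.symm_pure, PreTensor.symm_pure, PreTensor.tmul_eq]
  simp only [map_smul, LinearMap.smul_apply, map_sum, LinearMap.sum_apply, ← PreTensor.tmul_eq,
    PreTensor.tmul_pure]
  rw [symmTensorCMM]
  simp only [smul_apply, sum_apply]
  rw [Finset.smul_sum]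
  refine Finset.sum_congr rfl fun τ _ => ?_
  congr 2
  refine Finset.sum_congr rfl fun σ _ => ?_
  rw [ContinuousMultilinearMap.domDomCongr_apply, pureCMM_apply]
  congr 2
  ext (i | i) <;> rfl

/-- Totality of the basis tensors, in the form used below. Two families are allowed since the last
`n` factors use the conjugate basis. Continuity and multilinearity reach all `symmTensor v w`, and
bilinearity then all algebraic tensors. -/
theorem symPowTensorSymPow_le_of_basis (b c : ι → K)
    (hb : (Submodule.span ℂ (Set.range b)).topologicalClosure = ⊤)
    (hc : (Submodule.span ℂ (Set.range c)).topologicalClosure = ⊤)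
    (C : Submodule ℂ (HilbertTensor (Fin m ⊕ Fin n) K))
    (hC : IsClosed (C : Set (HilbertTensor (Fin m ⊕ Fin n) K)))
    (h : ∀ (a : Fin m → ι) (a' : Fin n → ι),
      symmTensor (fun i => b (a i)) (fun j => c (a' j)) ∈ C) :
    symPowTensorSymPow K m n ≤ C := by
  have h1 : ∀ (v : Fin m → K) (w : Fin n → K), symmTensor v w ∈ C := by
    intro v w
    have := ContinuousMultilinearMap.mem_of_forall_basis_mem (symmTensorCMM K m n) C hC
      (Sum.elim (fun _ => b) (fun _ => c)) (by rintro (i | i) <;> assumption)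
      (fun a => by
        rw [symmTensorCMM_apply]
        exact h (fun i => a (Sum.inl i)) (fun j => a (Sum.inr j))) (Sum.elim v w)
    rwa [symmTensorCMM_apply] at this
  refine Submodule.topologicalClosure_minimal _ (Submodule.span_le.2 ?_) hC
  rintro _ ⟨a, a', rfl⟩
  rw [SetLike.mem_coe]
  induction a using PreTensor.induction_pure with
  | add x y hx hy =>
    rw [PreTensor.tmul_eq, map_add, map_add, LinearMap.add_apply, map_add]
    exact C.add_mem hx hy
  | smul r v =>
  induction a' using PreTensor.induction_pure with
  | add x y hx hy =>
    rw [PreTensor.tmul_eq, map_add, map_add, map_add]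
    exact C.add_mem hx hy
  | smul s w =>
    rw [PreTensor.tmul_eq, map_smul, map_smul, map_smul, map_smul, LinearMap.smul_apply,
      map_smul, map_smul]
    exact C.smul_mem _ (C.smul_mem _ (h1 v w))

end Tensors

/-! ### Conjugation -/

section Conjugation

namespace Complexification

variable {H : Type*} [NormedAddCommGroup H] [InnerProductSpace ℝ H]

theorem inner_def (h k : Complexification H) : inner ℂ h k =
    (⟨inner ℝ h.re k.re + inner ℝ h.im k.im, inner ℝ h.re k.im - inner ℝ h.im k.re⟩ : ℂ) := rfl

theorem inner_conjugate (h k : Complexification H) :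
    inner ℂ h.conjugate k.conjugate = conj (inner ℂ h k) := by
  rw [inner_def, inner_def]
  apply Complex.ext <;> simp [conjugate]
  ring

theorem conjugate_add (h k : Complexification H) :
    (h + k).conjugate = h.conjugate + k.conjugate := by
  ext <;> simp [conjugate]; abel

theorem conjugate_smul (c : ℂ) (h : Complexification H) :
    (c • h).conjugate = conj c • h.conjugate := by
  ext <;> simp [conjugate]; abel

theorem conjugate_conjugate (h : Complexification H) : h.conjugate.conjugate = h := by
  ext <;> simp [conjugate]

theorem conjugate_zero : (0 : Complexification H).conjugate = 0 := by
  ext <;> simp [conjugate]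

theorem norm_conjugate (h : Complexification H) : ‖h.conjugate‖ = ‖h‖ := by
  rw [← sq_eq_sq₀ (norm_nonneg _) (norm_nonneg _), norm_sq_eq, norm_sq_eq]
  simp [conjugate]

theorem continuous_conjugate : Continuous (conjugate : Complexification H → Complexification H) := by
  have hd : ∀ h k : Complexification H, dist h.conjugate k.conjugate = dist h k := by
    intro h k
    have e : h.conjugate - k.conjugate = (h - k).conjugate := by
      rw [sub_eq_add_neg, sub_eq_add_neg, conjugate_add, ← neg_one_smul ℂ k, conjugate_smul]
      simp
    rw [dist_eq_norm, dist_eq_norm, e, norm_conjugate]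
  exact (Isometry.of_dist_eq hd).continuous

theorem orthonormal_conjugate {ι : Type*} {e : ι → Complexification H} (he : Orthonormal ℂ e) :
    Orthonormal ℂ fun k => (e k).conjugate :=
  ⟨fun k => by rw [norm_conjugate, he.1 k], fun j k hjk => by
    change inner ℂ (e j).conjugate (e k).conjugate = 0
    rw [inner_conjugate, he.2 hjk, map_zero]⟩

theorem topologicalClosure_span_conjugate {ι : Type*} {e : ι → Complexification H}
    (he : (Submodule.span ℂ (Set.range e)).topologicalClosure = ⊤) :
    (Submodule.span ℂ (Set.range fun k => (e k).conjugate)).topologicalClosure = ⊤ := by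
  set C := (Submodule.span ℂ (Set.range fun k => (e k).conjugate)).topologicalClosure with hCdef
  have hC : IsClosed (C : Set (Complexification H)) := Submodule.isClosed_topologicalClosure _
  -- Although conjugation is antilinear, the preimage of a complex subspace is again one, because
  -- the subspace is stable under every scalar `conj c`.
  let D : Submodule ℂ (Complexification H) :=
    { carrier := {h | h.conjugate ∈ C}
      add_mem' := fun {a b} ha hb => by
        change (a + b).conjugate ∈ C
        rw [conjugate_add]; exact C.add_mem ha hb
      zero_mem' := by
        change (0 : Complexification H).conjugate ∈ C
        rw [conjugate_zero]; exact C.zero_mem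
      smul_mem' := fun c h hh => by
        change (c • h).conjugate ∈ C
        rw [conjugate_smul]; exact C.smul_mem _ hh }
  have hD : IsClosed (D : Set (Complexification H)) := hC.preimage continuous_conjugate
  have hle : Submodule.span ℂ (Set.range e) ≤ D := by
    rw [Submodule.span_le]
    rintro _ ⟨k, rfl⟩
    exact Submodule.le_topologicalClosure _ (Submodule.subset_span ⟨k, rfl⟩)
  have htop : (⊤ : Submodule ℂ (Complexification H)) ≤ D :=
    he.symm.le.trans (Submodule.topologicalClosure_minimal _ hle hD)
  refine eq_top_iff.2 fun h _ => ?_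
  have : h.conjugate.conjugate ∈ C := htop (Submodule.mem_top (x := h.conjugate))
  rwa [conjugate_conjugate] at this

end Complexification

end Conjugation

end ComplexChaos

namespace ComplexChaos

/-! ### Polarization -/

section Polarization

variable {E : Type*} [AddCommGroup E] [Module ℂ E]

/-- Otherwise a linear functional vanishing on `V` but not at `A k` would turn the sum into a
nonzero polynomial with infinitely many roots. No topology is needed, so the lemma applies to spaces
of functions. -/
theorem mem_of_forall_sum_pow_smul_mem (V : Submodule ℂ E) {S : Set ℂ} (hS : S.Infinite) (N : ℕ)
    (A : ℕ → E) (h : ∀ c ∈ S, ∑ k ∈ Finset.range N, c ^ k • A k ∈ V) {k : ℕ} (hk : k < N) :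
    A k ∈ V := by
  by_contra hA
  obtain ⟨f, hf, hV⟩ := Submodule.exists_le_ker_of_notMem hA
  let p : Polynomial ℂ := ∑ k ∈ Finset.range N, Polynomial.monomial k (f (A k))
  have hp : p = 0 := by
    refine Polynomial.eq_zero_of_infinite_isRoot p (hS.mono fun c hc => ?_)
    have := hV (h c hc)
    rw [LinearMap.mem_ker, map_sum] at this
    rw [Set.mem_ofPred_eq, Polynomial.IsRoot, Polynomial.eval_finsetSum, ← this]
    refine Finset.sum_congr rfl fun k _ => ?_
    rw [Polynomial.eval_monomial, map_smul, smul_eq_mul, mul_comm]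
  have hc : p.coeff k = f (A k) := by
    simp only [p, Polynomial.finsetSum_coeff, Polynomial.coeff_monomial]
    rw [Finset.sum_ite_eq' (Finset.range N) k, if_pos (Finset.mem_range.2 hk)]
  rw [hp] at hc
  exact hf (by simpa using hc.symm)

/-- With c = r(1 + it), the powers of the real `r` separate the total degrees d = i + j. In a fixed
degree, the ratios (1 + it)/(1 - it) are infinitely many and their powers separate `i`. -/
theorem mem_of_forall_sum_pow_mul_conj_pow_smul_mem (V : Submodule ℂ E) (M N : ℕ) (A : ℕ → ℕ → E)
    (h : ∀ c : ℂ, ∑ i ∈ Finset.range M, ∑ j ∈ Finset.range N, (c ^ i * conj c ^ j) • A i j ∈ V)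
    {i j : ℕ} (hi : i < M) (hj : j < N) : A i j ∈ V := by
  obtain ⟨d, hd⟩ : ∃ d, d = i + j := ⟨_, rfl⟩
  have hne : ∀ t : ℝ, (1 - t * Complex.I : ℂ) ≠ 0 := by
    intro t ht
    have := congrArg Complex.re ht
    simp at this
  have hreal : (Set.range fun r : ℝ => (r : ℂ)).Infinite :=
    Set.infinite_range_of_injective Complex.ofReal_injective
  have hcircle : (Set.range fun t : ℝ => (1 + t * Complex.I : ℂ) / (1 - t * Complex.I)).Infinite := by
    refine Set.infinite_range_of_injective fun s t hst => ?_
    have := (div_eq_div_iff (hne s) (hne t)).1 hst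
    have := congrArg Complex.im this
    simp at this
    linarith
  have h1 : ∀ t : ℝ, ∑ i ∈ Finset.range M, ∑ j' ∈ Finset.range N,
      (if i + j' = d then ((1 + t * Complex.I : ℂ) ^ i * (1 - t * Complex.I) ^ j') • A i j'
        else 0) ∈ V := by
    intro t
    refine mem_of_forall_sum_pow_smul_mem V hreal (M + N) (fun d => ∑ i ∈ Finset.range M,
      ∑ j' ∈ Finset.range N,
        if i + j' = d then ((1 + t * Complex.I : ℂ) ^ i * (1 - t * Complex.I) ^ j') • A i j'
          else 0) ?_ (k := d) (by omega)
    rintro _ ⟨r, rfl⟩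
    convert h (r * (1 + t * Complex.I)) using 1
    simp only [Finset.smul_sum]
    rw [Finset.sum_comm]
    refine Finset.sum_congr rfl fun i hi => ?_
    rw [Finset.sum_comm]
    refine Finset.sum_congr rfl fun j' hj' => ?_
    have hi := Finset.mem_range.1 hi
    have hj' := Finset.mem_range.1 hj'
    rw [Finset.sum_eq_single_of_mem (i + j') (Finset.mem_range.2 (by omega))
      (fun d _ hd => by rw [if_neg hd.symm, smul_zero]), if_pos rfl, smul_smul]
    congr 1
    have hconj : conj ((r : ℂ) * (1 + t * Complex.I)) = r * (1 - t * Complex.I) := by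
      simp [sub_eq_add_neg]
    rw [hconj, mul_pow, mul_pow, pow_add]
    ring
  have h2 : ∀ t : ℝ, ∑ i ∈ Finset.range M, ((1 + t * Complex.I : ℂ) / (1 - t * Complex.I)) ^ i •
      (if i ≤ d ∧ d - i < N then A i (d - i) else 0) ∈ V := by
    intro t
    -- Division by (1 - it)^d turns (1 + it)^i (1 - it)^{d-i} into the i-th power of the ratio.
    convert V.smul_mem ((1 - t * Complex.I : ℂ) ^ d)⁻¹ (h1 t) using 1
    rw [Finset.smul_sum]
    refine Finset.sum_congr rfl fun i _ => ?_
    split_ifs with hid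
    · rw [Finset.sum_eq_single_of_mem (d - i) (Finset.mem_range.2 hid.2)
        (fun j' _ hj' => if_neg (by omega)), if_pos (by omega), smul_smul]
      congr 1
      have : (1 - t * Complex.I : ℂ) ^ d = (1 - t * Complex.I) ^ i * (1 - t * Complex.I) ^ (d - i) := by
        rw [← pow_add]; congr 1; omega
      have hn := hne t
      rw [this]
      field_simp
      rw [← mul_pow, div_mul_cancel₀ _ hn]
    · rw [smul_zero, Finset.sum_eq_zero, smul_zero]
      intro j' hj'
      have := Finset.mem_range.1 hj'
      exact if_neg (by omega)
  have h3 := mem_of_forall_sum_pow_smul_mem V hcircle M _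
    (by rintro _ ⟨t, rfl⟩; exact h2 t) hi
  rw [if_pos (by omega)] at h3
  rwa [hd, Nat.add_sub_cancel_left] at h3

end Polarization

/-! ### Random variables almost everywhere equal to an element of a subspace of `L²` -/

section AeSubmodule

variable {Ω : Type*} [MeasurableSpace Ω] {P : Measure Ω}

/-- The functions which are almost everywhere equal to an element of `V`. -/
def aeSubmodule (V : Submodule ℂ (Lp ℂ 2 P)) : Submodule ℂ (Ω → ℂ) where
  carrier := {f | ∃ F ∈ V, F =ᵐ[P] f}
  add_mem' := by
    rintro f g ⟨F, hF, hf⟩ ⟨G, hG, hg⟩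
    exact ⟨F + G, V.add_mem hF hG, (Lp.coeFn_add F G).trans (hf.add hg)⟩
  zero_mem' := ⟨0, V.zero_mem, Lp.coeFn_zero _ _ _⟩
  smul_mem' := by
    rintro c f ⟨F, hF, hf⟩
    exact ⟨c • F, V.smul_mem c hF, (Lp.coeFn_smul c F).trans (hf.const_smul c)⟩

theorem aeSubmodule_congr {V : Submodule ℂ (Lp ℂ 2 P)} {f g : Ω → ℂ} (h : f =ᵐ[P] g)
    (hf : f ∈ aeSubmodule V) : g ∈ aeSubmodule V := by
  obtain ⟨F, hF, hFf⟩ := hf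
  exact ⟨F, hF, hFf.trans h⟩

theorem toLp_mem_iff {V : Submodule ℂ (Lp ℂ 2 P)} {f : Ω → ℂ} (hf : MemLp f 2 P) :
    hf.toLp ∈ V ↔ f ∈ aeSubmodule V := by
  refine ⟨fun h => ⟨_, h, hf.coeFn_toLp⟩, ?_⟩
  rintro ⟨F, hF, hFf⟩
  have : hf.toLp = F := Lp.ext (hf.coeFn_toLp.trans hFf.symm)
  rwa [this]

theorem inner_toLp_toLp {f g : Ω → ℂ} (hf : MemLp f 2 P) (hg : MemLp g 2 P) :
    inner ℂ hf.toLp hg.toLp = ∫ ω, conj (f ω) * g ω ∂P := by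
  rw [L2.inner_def]
  refine integral_congr_ae ?_
  filter_upwards [hf.coeFn_toLp, hg.coeFn_toLp] with ω h1 h2
  rw [h1, h2, RCLike.inner_apply, mul_comm]

end AeSubmodule

/-! ### Hermite polynomials of a circular isonormal process -/

section HermZ

variable {Ω : Type*} [MeasurableSpace Ω] {P : Measure Ω}
  {K : Type*} [NormedAddCommGroup K] [InnerProductSpace ℂ K] {ι : Type*}

/-- The complex Hermite polynomial of bidegree `(m, n)` and variance `‖h‖²` at `Z(h)`. -/
def hermZ (Z : K → Ω → ℂ) (m n : ℕ) (h : K) (ω : Ω) : ℂ :=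
  herm ((‖h‖ : ℂ) ^ 2) (Z h ω) (conj (Z h ω)) m n

/-- The product over `k` of the Hermite polynomials of bidegree `(μₖ, νₖ)` at `Z(eₖ)`. -/
def prodHerm (Z : K → Ω → ℂ) (e : ι → K) (μ ν : ι →₀ ℕ) (ω : Ω) : ℂ :=
  ∏ k ∈ (μ + ν).support, hermZ Z (μ k) (ν k) (e k) ω

theorem hermZ_zero_zero (Z : K → Ω → ℂ) (h : K) (ω : Ω) : hermZ Z 0 0 h ω = 1 := by
  rw [hermZ, herm_zero_left, pow_zero]

theorem prodHerm_eq_prod (Z : K → Ω → ℂ) (e : ι → K) {μ ν : ι →₀ ℕ} {T : Finset ι}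
    (hμ : μ.support ⊆ T) (hν : ν.support ⊆ T) (ω : Ω) :
    prodHerm Z e μ ν ω = ∏ k ∈ T, hermZ Z (μ k) (ν k) (e k) ω := by
  classical
  rw [prodHerm]
  refine Finset.prod_subset (Finsupp.support_add.trans (Finset.union_subset hμ hν)) fun k _ hk => ?_
  have : μ k + ν k = 0 := by simpa using Finsupp.notMem_support_iff.1 hk
  rw [(Nat.add_eq_zero_iff.1 this).1, (Nat.add_eq_zero_iff.1 this).2, hermZ_zero_zero]

theorem prodHerm_add_single (Z : K → Ω → ℂ) (e : ι → K) {μ ν : ι →₀ ℕ} {k : ι}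
    (hμ : μ k = 0) (hν : ν k = 0) (i j : ℕ) (ω : Ω) :
    prodHerm Z e (μ + Finsupp.single k i) (ν + Finsupp.single k j) ω =
      hermZ Z i j (e k) ω * prodHerm Z e μ ν ω := by
  classical
  set T : Finset ι := (μ.support ∪ ν.support).erase k with hT
  have hk : k ∉ T := by simp [hT]
  have h1 : ∀ {μ : ι →₀ ℕ}, μ k = 0 → μ.support ⊆ μ.support.erase k := fun h l hl =>
    Finset.mem_erase.2 ⟨fun hlk => by subst hlk; exact Finsupp.mem_support_iff.1 hl h, hl⟩
  have hμT : μ.support ⊆ T := (h1 hμ).trans (Finset.erase_subset_erase _ Finset.subset_union_left)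
  have hνT : ν.support ⊆ T := (h1 hν).trans (Finset.erase_subset_erase _ Finset.subset_union_right)
  have h2 : ∀ {μ : ι →₀ ℕ} {i : ℕ}, μ.support ⊆ T →
      (μ + Finsupp.single k i).support ⊆ insert k T := by
    intro μ i h
    refine Finsupp.support_add.trans (Finset.union_subset (h.trans (Finset.subset_insert _ _)) ?_)
    exact Finsupp.support_single_subset.trans (by simp)
  rw [prodHerm_eq_prod Z e (h2 hμT) (h2 hνT), prodHerm_eq_prod Z e hμT hνT, Finset.prod_insert hk]
  congr 1
  · simp [hμ, hν]
  · refine Finset.prod_congr rfl fun l hl => ?_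
    have hlk : k ≠ l := fun h => hk (h ▸ hl)
    simp [Finsupp.single_eq_of_ne' hlk]

namespace IsCircularIsonormal

variable {Z : K → Ω → ℂ} (hZ : IsCircularIsonormal Z P)
include hZ

theorem memAllLp_hermZ (m n : ℕ) (h : K) : MemAllLp (hermZ Z m n h) P :=
  have := hZ.isProbabilityMeasure
  (hZ.memAllLp h).herm (hZ.memAllLp h).star _ _ _

theorem memAllLp_prodHerm (e : ι → K) (μ ν : ι →₀ ℕ) : MemAllLp (prodHerm Z e μ ν) P :=
  have := hZ.isProbabilityMeasure
  MemAllLp.prod _ fun k => hZ.memAllLp_hermZ (μ k) (ν k) (e k)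

theorem hermZ_smul_ae (c : ℂ) (m n : ℕ) (h : K) :
    hermZ Z m n (c • h) =ᵐ[P] fun ω => c ^ m * conj c ^ n * hermZ Z m n h ω := by
  filter_upwards [hZ.smul_ae c h] with ω hω
  have : ((‖c • h‖ : ℂ)) ^ 2 = c * conj c * (‖h‖ : ℂ) ^ 2 := by
    rw [norm_smul, Complex.mul_conj, Complex.normSq_eq_norm_sq]
    push_cast; ring
  rw [hermZ, hω, this, map_mul, herm_scale, hermZ]

theorem hermZ_zero_ae {m n : ℕ} (hmn : m + n ≠ 0) : hermZ Z m n 0 =ᵐ[P] 0 := by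
  filter_upwards [hZ.zero_ae] with ω hω
  rw [hermZ, hω, norm_zero, map_zero, Complex.ofReal_zero, zero_pow two_ne_zero,
    herm_zero_zero_zero _ _ hmn, Pi.zero_apply]

/-- By Pythagoras the variances ‖g‖² and ‖h‖² add up to ‖g + h‖², as `herm_add` requires. -/
theorem hermZ_add_ae {g h : K} (hgh : inner ℂ g h = 0) (m n : ℕ) :
    hermZ Z m n (g + h) =ᵐ[P] fun ω =>
      ∑ i ∈ Finset.range (m + 1), ∑ j ∈ Finset.range (n + 1), (m.choose i * n.choose j : ℂ) *
        (hermZ Z i j g ω * hermZ Z (m - i) (n - j) h ω) := by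
  filter_upwards [hZ.add_ae g h] with ω hω
  have : ((‖g + h‖ : ℂ)) ^ 2 = (‖g‖ : ℂ) ^ 2 + (‖h‖ : ℂ) ^ 2 := by
    have := norm_add_sq_eq_norm_sq_add_norm_sq_of_inner_eq_zero (𝕜 := ℂ) g h hgh
    simp only [← pow_two] at this
    exact_mod_cast this
  rw [hermZ, hω, this, map_add, herm_add]
  rfl

/-- The dependence on `c` is isolated in the monomials c^i c̄^j, ready for polarization. -/
theorem hermZ_smul_add_ae {g h : K} (hgh : inner ℂ g h = 0) (c : ℂ) (m n : ℕ) :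
    hermZ Z m n (c • g + h) =ᵐ[P] fun ω =>
      ∑ i ∈ Finset.range (m + 1), ∑ j ∈ Finset.range (n + 1), (c ^ i * conj c ^ j) *
        ((m.choose i * n.choose j : ℂ) * (hermZ Z i j g ω * hermZ Z (m - i) (n - j) h ω)) := by
  have h1 := hZ.hermZ_add_ae (g := c • g) (h := h) (by rw [inner_smul_left, hgh, mul_zero]) m n
  have h2 : ∀ᵐ ω ∂P, ∀ i j, hermZ Z i j (c • g) ω = c ^ i * conj c ^ j * hermZ Z i j g ω :=
    ae_all_iff.2 fun i => ae_all_iff.2 fun j => hZ.hermZ_smul_ae c i j g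
  filter_upwards [h1, h2] with ω e1 e2
  rw [e1]
  refine Finset.sum_congr rfl fun i _ => Finset.sum_congr rfl fun j _ => ?_
  rw [e2]
  ring

theorem integral_conj_hermZ_mul_hermZ (h : K) (m n m' n' : ℕ) :
    ∫ ω, conj (hermZ Z m' n' h ω) * hermZ Z m n h ω ∂P =
      if m = m' ∧ n = n' then (m ! * n ! * ((‖h‖ : ℂ) ^ 2) ^ (m + n) : ℂ) else 0 :=
  hZ.integral_conj_herm_mul_herm h m n m' n'

theorem integral_hermZ (h : K) (m n : ℕ) :
    ∫ ω, hermZ Z m n h ω ∂P = if m = 0 ∧ n = 0 then 1 else 0 := by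
  have h1 := hZ.integral_conj_hermZ_mul_hermZ h m n 0 0
  simp only [hermZ_zero_zero, map_one, one_mul] at h1
  rw [h1]
  split_ifs with h2
  · simp [h2.1, h2.2]
  · rfl

theorem continuous_herm_conj (r : ℂ) (m n : ℕ) : Continuous fun z => herm r z (conj z) m n :=
  continuous_iff_continuousAt.2 fun z => (hasFDerivAt_herm r m n z).continuousAt

-- Variables at distinct basis vectors are independent, so the expectation factors into one-variable
-- orthogonality relations.
open scoped Classical in
theorem integral_conj_prodHerm_mul_prodHerm {e : ι → K} (he : Orthonormal ℂ e)
    (μ ν μ' ν' : ι →₀ ℕ) :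
    ∫ ω, conj (prodHerm Z e μ' ν' ω) * prodHerm Z e μ ν ω ∂P =
      if μ = μ' ∧ ν = ν' then (multiFactorial μ * multiFactorial ν : ℂ) else 0 := by
  classical
  -- All four multi-indices are supported in `T`, so both products run over the same finite set; the
  -- extra factors are 1.
  set T : Finset ι := (μ.support ∪ ν.support) ∪ (μ'.support ∪ ν'.support) with hT
  have s1 : μ.support ⊆ T := fun k hk => by simp only [hT, Finset.mem_union]; tauto
  have s2 : ν.support ⊆ T := fun k hk => by simp only [hT, Finset.mem_union]; tauto
  have s3 : μ'.support ⊆ T := fun k hk => by simp only [hT, Finset.mem_union]; tauto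
  have s4 : ν'.support ⊆ T := fun k hk => by simp only [hT, Finset.mem_union]; tauto
  have hind := hZ.iIndepFun (fun k : T => e k) fun j k hjk =>
    he.2 fun h => hjk (Subtype.ext h)
  let f : T → ℂ → ℂ := fun k z => conj (herm ((‖e k‖ : ℂ) ^ 2) z (conj z) (μ' k) (ν' k)) *
    herm ((‖e k‖ : ℂ) ^ 2) z (conj z) (μ k) (ν k)
  have hf : ∀ k, Continuous (f k) := fun k =>
    (Complex.continuous_conj.comp (continuous_herm_conj hZ _ _ _)).mul
      (continuous_herm_conj hZ _ _ _)
  have h1 := hind.integral_fun_prod_comp (f := f)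
    (fun k => hZ.isGaussianProcess.aemeasurable (e k)) fun k => (hf k).aestronglyMeasurable
  have h2 : ∀ ω, conj (prodHerm Z e μ' ν' ω) * prodHerm Z e μ ν ω = ∏ k : T, f k (Z (e k) ω) := by
    intro ω
    rw [prodHerm_eq_prod Z e s3 s4, prodHerm_eq_prod Z e s1 s2, map_prod,
      ← Finset.prod_mul_distrib, ← Finset.prod_coe_sort]
    rfl
  simp only [h2]
  rw [h1]
  have h3 : ∀ k : T, ∫ ω, f k (Z (e k) ω) ∂P =
      if μ k = μ' k ∧ ν k = ν' k then ((μ k)! * (ν k)! : ℂ) else 0 := by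
    intro k
    have := hZ.integral_conj_hermZ_mul_hermZ (e k) (μ k) (ν k) (μ' k) (ν' k)
    refine this.trans ?_
    simp [he.1]
  simp only [h3]
  have hfac : ∀ {μ : ι →₀ ℕ}, μ.support ⊆ T → multiFactorial μ = ∏ k ∈ T, (μ k)! := by
    intro μ h
    rw [multiFactorial, Finsupp.prod_of_support_subset _ h _ (fun _ _ => rfl)]
  split_ifs with h
  · obtain ⟨rfl, rfl⟩ := h
    simp only [and_self, if_true]
    rw [Finset.prod_coe_sort T fun k => ((μ k)! * (ν k)! : ℂ), Finset.prod_mul_distrib, hfac s1,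
      hfac s2]
    push_cast
    rfl
  · have : ∃ k, ¬ (μ k = μ' k ∧ ν k = ν' k) := by
      by_contra hall
      push Not at hall
      exact h ⟨Finsupp.ext fun k => (hall k).1, Finsupp.ext fun k => (hall k).2⟩
    obtain ⟨k, hk⟩ := this
    have hkT : k ∈ T := by
      by_contra hkT
      have hz : ∀ {μ : ι →₀ ℕ}, μ.support ⊆ T → μ k = 0 := fun h =>
        Finsupp.notMem_support_iff.1 fun hk => hkT (h hk)
      exact hk ⟨by rw [hz s1, hz s3], by rw [hz s2, hz s4]⟩
    exact Finset.prod_eq_zero (Finset.mem_univ ⟨k, hkT⟩) (if_neg hk)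

/-- In the expansion at g + r, independence splits off the mean of a Hermite variable at `r`, which
vanishes unless its bidegree is (0, 0). Only the term at i = m, j = n remains. -/
theorem integral_conj_hermZ_mul_hermZ_add {g r : K} (hgr : inner ℂ g r = 0) (m n : ℕ) :
    ∫ ω, conj (hermZ Z m n g ω) * hermZ Z m n (g + r) ω ∂P =
      (m ! * n ! * ((‖g‖ : ℂ) ^ 2) ^ (m + n) : ℂ) := by
  have hprod : ∀ i j k l, ∫ ω, (conj (hermZ Z m n g ω) * hermZ Z i j g ω) * hermZ Z k l r ω ∂P =
      (∫ ω, conj (hermZ Z m n g ω) * hermZ Z i j g ω ∂P) * ∫ ω, hermZ Z k l r ω ∂P := by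
    intro i j k l
    exact (hZ.indepFun hgr).integral_fun_comp_mul_comp
      (f := fun z => conj (herm ((‖g‖ : ℂ) ^ 2) z (conj z) m n) *
        herm ((‖g‖ : ℂ) ^ 2) z (conj z) i j)
      (g := fun z => herm ((‖r‖ : ℂ) ^ 2) z (conj z) k l)
      (hZ.isGaussianProcess.aemeasurable g) (hZ.isGaussianProcess.aemeasurable r)
      ((Complex.continuous_conj.comp (continuous_herm_conj hZ _ _ _)).mul
        (continuous_herm_conj hZ _ _ _)).aestronglyMeasurable
      (continuous_herm_conj hZ _ _ _).aestronglyMeasurable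
  have hint : ∀ i j k l, Integrable
      (fun ω => (m.choose i * n.choose j : ℂ) *
        ((conj (hermZ Z m n g ω) * hermZ Z i j g ω) * hermZ Z k l r ω)) P := fun i j k l =>
    ((((hZ.memAllLp_hermZ m n g).star.mul (hZ.memAllLp_hermZ i j g)).mul
      (hZ.memAllLp_hermZ k l r)).const_mul _).integrable
  have h1 : ∫ ω, conj (hermZ Z m n g ω) * hermZ Z m n (g + r) ω ∂P =
      ∫ ω, ∑ i ∈ Finset.range (m + 1), ∑ j ∈ Finset.range (n + 1), (m.choose i * n.choose j : ℂ) *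
        ((conj (hermZ Z m n g ω) * hermZ Z i j g ω) * hermZ Z (m - i) (n - j) r ω) ∂P := by
    refine integral_congr_ae ?_
    filter_upwards [hZ.hermZ_add_ae hgr m n] with ω hω
    rw [hω, Finset.mul_sum]
    refine Finset.sum_congr rfl fun i _ => ?_
    rw [Finset.mul_sum]
    refine Finset.sum_congr rfl fun j _ => ?_
    ring
  rw [h1, integral_finsetSum _ fun i _ => integrable_finsetSum _ fun j _ => hint i j _ _,
    Finset.sum_eq_single_of_mem m (by simp)]
  · rw [integral_finsetSum _ fun j _ => hint m j _ _, Finset.sum_eq_single_of_mem n (by simp)]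
    · rw [integral_const_mul, hprod, hZ.integral_hermZ, hZ.integral_conj_hermZ_mul_hermZ]
      simp
    · intro j hj hjn
      rw [integral_const_mul, hprod, hZ.integral_hermZ, if_neg, mul_zero, mul_zero]
      have := Finset.mem_range.1 hj
      omega
  · intro i hi him
    rw [integral_finsetSum _ fun j _ => hint i j _ _]
    refine Finset.sum_eq_zero fun j _ => ?_
    rw [integral_const_mul, hprod, hZ.integral_hermZ, if_neg, mul_zero, mul_zero]
    have := Finset.mem_range.1 hi
    omega

theorem norm_sq_toLp_hermZ (m n : ℕ) (h : K) :
    ‖(hZ.memAllLp_hermZ m n h).memLp_two.toLp‖ ^ 2 = m ! * n ! * (‖h‖ ^ 2) ^ (m + n) := by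
  have h1 := inner_self_eq_norm_sq_to_K (𝕜 := ℂ) (hZ.memAllLp_hermZ m n h).memLp_two.toLp
  rw [inner_toLp_toLp, hZ.integral_conj_hermZ_mul_hermZ, if_pos ⟨rfl, rfl⟩] at h1
  have h2 := h1.symm
  apply Complex.ofReal_injective
  push_cast
  exact h2

/-- The cross term equals the squared norm at `g`, so the difference obeys Pythagoras. This makes
Hermite variables converge along orthogonal expansions. -/
theorem norm_sq_toLp_hermZ_add_sub {g r : K} (hgr : inner ℂ g r = 0) (m n : ℕ) :
    ‖(hZ.memAllLp_hermZ m n (g + r)).memLp_two.toLp -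
      (hZ.memAllLp_hermZ m n g).memLp_two.toLp‖ ^ 2 =
        m ! * n ! * (‖g + r‖ ^ 2) ^ (m + n) - m ! * n ! * (‖g‖ ^ 2) ^ (m + n) := by
  rw [norm_sub_sq (𝕜 := ℂ), hZ.norm_sq_toLp_hermZ, hZ.norm_sq_toLp_hermZ, inner_re_symm,
    inner_toLp_toLp, hZ.integral_conj_hermZ_mul_hermZ_add hgr]
  have : (m ! * n ! * ((‖g‖ : ℂ) ^ 2) ^ (m + n) : ℂ) =
      ((m ! * n ! * (‖g‖ ^ 2) ^ (m + n) : ℝ) : ℂ) := by push_cast; rfl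
  rw [this]
  simp only [RCLike.re_eq_complex_re, Complex.ofReal_re]
  ring

/-- The partial sums of the expansion of `h` are orthogonal to their remainders. The squared
distance is therefore m! n! times the difference of the powers ‖·‖^{2(m+n)}, which tends to zero. -/
theorem hermZ_mem_of_forall_finset {V : Submodule ℂ (Lp ℂ 2 P)}
    (hV : IsClosed (V : Set (Lp ℂ 2 P))) (e : HilbertBasis ι ℂ K) {m n : ℕ}
    (hfin : ∀ (s : Finset ι) (c : ι → ℂ), hermZ Z m n (∑ k ∈ s, c k • e k) ∈ aeSubmodule V)
    (h : K) : hermZ Z m n h ∈ aeSubmodule V := by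
  rw [← toLp_mem_iff (hZ.memAllLp_hermZ m n h).memLp_two]
  set F : Finset ι → K := fun s => ∑ k ∈ s, e.repr h k • e k with hF
  have hlim : Filter.Tendsto F Filter.atTop (nhds h) := e.hasSum_repr h
  refine hV.mem_of_tendsto (b := Filter.atTop)
    (f := fun s => (hZ.memAllLp_hermZ m n (F s)).memLp_two.toLp) ?_
    (Filter.Eventually.of_forall fun s => (toLp_mem_iff _).2 (hfin s _))
  rw [tendsto_iff_norm_sub_tendsto_zero]
  have horth : ∀ s, inner ℂ (F s) (h - F s) = 0 := by
    intro s
    have h1 : ∀ k ∈ s, inner ℂ (e k) (h - F s) = 0 := by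
      intro k hk
      rw [inner_sub_right, hF, e.orthonormal.inner_right_sum _ hk, e.repr_apply_apply, sub_self]
    rw [hF, sum_inner]
    refine Finset.sum_eq_zero fun k hk => ?_
    rw [inner_smul_left, h1 k hk, mul_zero]
  have hsq : ∀ s, ‖(hZ.memAllLp_hermZ m n (F s)).memLp_two.toLp -
      (hZ.memAllLp_hermZ m n h).memLp_two.toLp‖ =
        √(m ! * n ! * (‖h‖ ^ 2) ^ (m + n) - m ! * n ! * (‖F s‖ ^ 2) ^ (m + n)) := by
    intro s
    have h2 := hZ.norm_sq_toLp_hermZ_add_sub (horth s) m n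
    simp only [add_sub_cancel] at h2
    rw [← h2, Real.sqrt_sq (norm_nonneg _), norm_sub_rev]
  simp only [hsq]
  have hcont : Filter.Tendsto
      (fun s => √(m ! * n ! * (‖h‖ ^ 2) ^ (m + n) - m ! * n ! * (‖F s‖ ^ 2) ^ (m + n)))
      Filter.atTop
      (nhds (√(m ! * n ! * (‖h‖ ^ 2) ^ (m + n) - m ! * n ! * (‖h‖ ^ 2) ^ (m + n)))) := by
    refine (Real.continuous_sqrt.tendsto _).comp ?_
    exact tendsto_const_nhds.sub (((hlim.norm.pow 2).pow (m + n)).const_mul _)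
  simpa using hcont

theorem hermZ_sum_mem {V : Submodule ℂ (Lp ℂ 2 P)} {e : ι → K} (he : Orthonormal ℂ e) {m n : ℕ}
    (hV : ∀ μ ν : ι →₀ ℕ, μ.degree = m → ν.degree = n → prodHerm Z e μ ν ∈ aeSubmodule V)
    (s : Finset ι) (c : ι → ℂ) : hermZ Z m n (∑ k ∈ s, c k • e k) ∈ aeSubmodule V := by
  classical
  -- Strengthened for induction: basis vectors already split off are recorded in the product, while
  -- the rest of the sum carries the remaining bidegree `(p, q)`.
  suffices h : ∀ (s : Finset ι) (μ ν : ι →₀ ℕ) (p q : ℕ), (∀ k ∈ s, μ k = 0 ∧ ν k = 0) →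
      μ.degree + p = m → ν.degree + q = n →
      (fun ω => prodHerm Z e μ ν ω * hermZ Z p q (∑ k ∈ s, c k • e k) ω) ∈ aeSubmodule V by
    have := h s 0 0 m n (by simp) (by simp) (by simp)
    simpa [prodHerm] using this
  clear s
  intro s
  induction s using Finset.induction_on with
  | empty =>
    intro μ ν p q _ hp hq
    rw [Finset.sum_empty]
    -- At the zero vector the Hermite variable is 1 in bidegree (0, 0) and almost surely 0
    -- otherwise, so only products of full degree remain.
    by_cases hpq : p + q = 0
    · obtain ⟨rfl, rfl⟩ := Nat.add_eq_zero_iff.1 hpq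
      simpa [hermZ_zero_zero] using hV μ ν hp hq
    · refine aeSubmodule_congr ?_ (aeSubmodule V).zero_mem
      filter_upwards [hZ.hermZ_zero_ae hpq] with ω hω
      simp [hω]
  | insert k s hk ih =>
    intro μ ν p q hs hp hq
    rw [Finset.sum_insert hk]
    have horth : inner ℂ (e k) (∑ l ∈ s, c l • e l) = 0 := by
      rw [inner_sum]
      refine Finset.sum_eq_zero fun l hl => ?_
      rw [inner_smul_right, he.2 (ne_of_mem_of_not_mem hl hk).symm, mul_zero]
    have hmem : ∑ i ∈ Finset.range (p + 1), ∑ j ∈ Finset.range (q + 1),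
        ((c k ^ i * conj (c k) ^ j) * (p.choose i * q.choose j : ℂ)) •
          (fun ω => prodHerm Z e (μ + Finsupp.single k i) (ν + Finsupp.single k j) ω *
            hermZ Z (p - i) (q - j) (∑ l ∈ s, c l • e l) ω) ∈ aeSubmodule V := by
      refine Submodule.sum_mem _ fun i hi => Submodule.sum_mem _ fun j hj => ?_
      have hi := Finset.mem_range.1 hi
      have hj := Finset.mem_range.1 hj
      refine Submodule.smul_mem _ _ (ih _ _ _ _ (fun l hl => ?_) ?_ ?_)
      · have hlk : k ≠ l := fun h => hk (h ▸ hl)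
        have := hs l (Finset.mem_insert_of_mem hl)
        simp [Finsupp.single_eq_of_ne' hlk, this.1, this.2]
      · simp only [map_add, Finsupp.degree_single]; omega
      · simp only [map_add, Finsupp.degree_single]; omega
    refine aeSubmodule_congr ?_ hmem
    filter_upwards [hZ.hermZ_smul_add_ae horth (c k) p q] with ω hω
    have hk0 := hs k (Finset.mem_insert_self _ _)
    rw [hω, Finset.mul_sum, Finset.sum_apply]
    refine Finset.sum_congr rfl fun i _ => ?_
    rw [Finset.mul_sum, Finset.sum_apply]
    refine Finset.sum_congr rfl fun j _ => ?_
    rw [Pi.smul_apply, smul_eq_mul, prodHerm_add_single Z e hk0.1 hk0.2]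
    ring

theorem prodHerm_mem {V : Submodule ℂ (Lp ℂ 2 P)} {e : ι → K} (he : Orthonormal ℂ e) {m n : ℕ}
    (hV : ∀ h : K, hermZ Z m n h ∈ aeSubmodule V) {μ ν : ι →₀ ℕ}
    (hμ : μ.degree = m) (hν : ν.degree = n) : prodHerm Z e μ ν ∈ aeSubmodule V := by
  classical
  -- Strengthened for induction: a vector `r` orthogonal to the basis vectors in `t` carries the
  -- bidegree not yet used. The claim is the case p = q = 0, r = 0.
  suffices h : ∀ (t : Finset ι) (μ ν : ι →₀ ℕ) (p q : ℕ) (r : K), μ.support ⊆ t → ν.support ⊆ t →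
      μ.degree + p = m → ν.degree + q = n → (∀ k ∈ t, inner ℂ (e k) r = 0) →
      (fun ω => prodHerm Z e μ ν ω * hermZ Z p q r ω) ∈ aeSubmodule V by
    have := h (μ.support ∪ ν.support) μ ν 0 0 0 Finset.subset_union_left Finset.subset_union_right
      hμ hν (by simp)
    simpa [hermZ_zero_zero] using this
  clear μ ν hμ hν
  intro t
  induction t using Finset.induction_on with
  | empty =>
    intro μ ν p q r hμ hν hp hq _
    obtain rfl : μ = 0 := by simpa using hμ
    obtain rfl : ν = 0 := by simpa using hν
    obtain rfl : p = m := by simpa using hp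
    obtain rfl : q = n := by simpa using hq
    simpa [prodHerm] using hV r
  | insert k t hk ih =>
    intro μ ν p q r hμ hν hp hq hr
    set μ₀ := μ.erase k with hμ₀
    set ν₀ := ν.erase k with hν₀
    have eμ : μ₀ + Finsupp.single k (μ k) = μ := Finsupp.erase_add_single k μ
    have eν : ν₀ + Finsupp.single k (ν k) = ν := Finsupp.erase_add_single k ν
    have dμ : μ₀.degree + (p + μ k) = m := by
      rw [← hp, ← eμ]; simp [hμ₀]; ring
    have dν : ν₀.degree + (q + ν k) = n := by
      rw [← hq, ← eν]; simp [hν₀]; ring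
    have hsub : ∀ {μ : ι →₀ ℕ}, μ.support ⊆ insert k t → (μ.erase k).support ⊆ t := by
      intro μ h
      rw [Finsupp.support_erase]
      exact Finset.subset_insert_iff.1 h
    -- The inductive hypothesis is applied to c e_k + r for every `c`, with the degrees at `k` moved
    -- into the Hermite variable. The coefficient of c^{μ_k} c̄^{ν_k} is the wanted product, up to
    -- nonzero binomial coefficients.
    have hpol := mem_of_forall_sum_pow_mul_conj_pow_smul_mem (aeSubmodule V) (p + μ k + 1)
      (q + ν k + 1) (fun i j ω => ((p + μ k).choose i * (q + ν k).choose j : ℂ) *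
        (prodHerm Z e μ₀ ν₀ ω * (hermZ Z i j (e k) ω *
          hermZ Z (p + μ k - i) (q + ν k - j) r ω))) (by
        intro c
        refine aeSubmodule_congr ?_ (ih μ₀ ν₀ (p + μ k) (q + ν k) (c • e k + r)
          (hsub hμ) (hsub hν) dμ dν fun l hl => ?_)
        · filter_upwards [hZ.hermZ_smul_add_ae (hr k (Finset.mem_insert_self _ _)) c (p + μ k)
            (q + ν k)] with ω hω
          rw [hω, Finset.mul_sum, Finset.sum_apply]
          refine Finset.sum_congr rfl fun i _ => ?_
          rw [Finset.mul_sum, Finset.sum_apply]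
          refine Finset.sum_congr rfl fun j _ => ?_
          rw [Pi.smul_apply, smul_eq_mul]
          ring
        · rw [inner_add_right, inner_smul_right, he.2 (ne_of_mem_of_not_mem hl hk),
            hr l (Finset.mem_insert_of_mem hl), mul_zero, add_zero])
      (i := μ k) (j := ν k) (by omega) (by omega)
    have hne : ((p + μ k).choose (μ k) * (q + ν k).choose (ν k) : ℂ) ≠ 0 := by
      have h1 := Nat.choose_pos (n := p + μ k) (k := μ k) (by omega)
      have h2 := Nat.choose_pos (n := q + ν k) (k := ν k) (by omega)
      exact_mod_cast (Nat.mul_pos h1 h2).ne'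
    have hfin := (aeSubmodule V).smul_mem
      ((p + μ k).choose (μ k) * (q + ν k).choose (ν k) : ℂ)⁻¹ hpol
    convert hfin using 1
    ext ω
    rw [Pi.smul_apply, smul_eq_mul, inv_mul_cancel_left₀ hne, Nat.add_sub_cancel,
      Nat.add_sub_cancel]
    conv_lhs => rw [← eμ, ← eν]
    rw [prodHerm_add_single Z e (by simp [hμ₀]) (by simp [hν₀])]
    ring

end IsCircularIsonormal

end HermZ

end ComplexChaos

namespace ComplexChaos

/-! ### The chaos spaces -/

section Chaos

variable {Ω : Type*} [MeasurableSpace Ω] {P : Measure Ω} {H : Type*} [NormedAddCommGroup H]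
  [InnerProductSpace ℝ H] {ι : Type*} {Z : Complexification H → Ω → ℂ}

theorem hermiteJ_eq_hermZ {h : Complexification H} (hh : ‖h‖ = √2) (m n : ℕ) (ω : Ω) :
    hermiteJ m n (Z h ω) = hermZ Z m n h ω := by
  have : ((√2 : ℝ) : ℂ) ^ 2 = 2 := by
    rw [← Complex.ofReal_pow, Real.sq_sqrt (by norm_num)]; simp
  rw [hermiteJ_eq_herm, hermZ, hh, this]

/-- By `herm_scale`, variance 2 at √2 Z(e_k) becomes variance 1 at Z(e_k) with a factor
√2^{μ_k+ν_k}. This cancels the power of 2 in the normalization. -/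
theorem fourierHermite_eq {e : ι → Complexification H} (he : ∀ k, ‖e k‖ = 1) (μ ν : ι →₀ ℕ)
    (ω : Ω) : fourierHermite Z e μ ν ω =
      ((√(multiFactorial μ * multiFactorial ν : ℝ))⁻¹ : ℝ) * prodHerm Z e μ ν ω := by
  classical
  have hfac : ∀ {μ : ι →₀ ℕ} {T : Finset ι}, μ.support ⊆ T →
      (multiFactorial μ : ℝ) = ∏ k ∈ T, ((μ k)! : ℝ) := by
    intro μ T h
    rw [multiFactorial, Finsupp.prod_of_support_subset _ h _ (fun _ _ => rfl)]
    push_cast; rfl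
  have hμ : μ.support ⊆ (μ + ν).support := fun k hk => by
    simp only [Finsupp.mem_support_iff, Finsupp.add_apply] at hk ⊢; omega
  have hν : ν.support ⊆ (μ + ν).support := fun k hk => by
    simp only [Finsupp.mem_support_iff, Finsupp.add_apply] at hk ⊢; omega
  rw [fourierHermite, prodHerm, hfac hμ, hfac hν, ← Finset.prod_mul_distrib,
    Real.sqrt_prod _ (fun k _ => by positivity), ← Finset.prod_inv_distrib, Complex.ofReal_prod,
    ← Finset.prod_mul_distrib]
  refine Finset.prod_congr rfl fun k _ => ?_
  have h2 : ((√2 : ℝ) : ℂ) * ((√2 : ℝ) : ℂ) = 2 := by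
    rw [← Complex.ofReal_mul, Real.mul_self_sqrt (by norm_num)]; simp
  have h3 := herm_scale (1 : ℂ) (Z (e k) ω) (conj (Z (e k) ω)) ((√2 : ℝ) : ℂ) ((√2 : ℝ) : ℂ)
    (μ k) (ν k)
  rw [h2, mul_one, ← pow_add] at h3
  rw [hermiteJ_eq_herm, map_mul, Complex.conj_ofReal, h3, hermZ, he, Complex.ofReal_one, one_pow,
    ← mul_assoc]
  congr 1
  rw [← Complex.ofReal_pow, ← Complex.ofReal_mul]
  congr 1
  have h4 : √(2 ^ (μ k + ν k) * (μ k)! * (ν k)! : ℝ) =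
      √2 ^ (μ k + ν k) * √((μ k)! * (ν k)! : ℝ) := by
    rw [mul_assoc, Real.sqrt_mul (by positivity)]
    congr 1
    rw [Real.sqrt_eq_iff_mul_self_eq (by positivity) (by positivity), ← mul_pow,
      Real.mul_self_sqrt (by norm_num)]
  have h5 : √2 ^ (μ k + ν k) ≠ 0 := by positivity
  rw [h4]
  field_simp

variable (hZ : IsCircularIsonormal Z P)
include hZ

theorem memLp_fourierHermite {e : ι → Complexification H} (he : ∀ k, ‖e k‖ = 1) (μ ν : ι →₀ ℕ) :
    MemLp (fourierHermite Z e μ ν) 2 P := by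
  have h := ((hZ.memAllLp_prodHerm e μ ν).const_mul
    (((√(multiFactorial μ * multiFactorial ν : ℝ))⁻¹ : ℝ) : ℂ)).memLp_two
  simpa only [← fourierHermite_eq he] using h

theorem orthonormal_fourierHermite {e : ι → Complexification H} (he : Orthonormal ℂ e) :
    Orthonormal ℂ fun p : (ι →₀ ℕ) × (ι →₀ ℕ) =>
      (memLp_fourierHermite hZ he.1 p.1 p.2).toLp := by
  classical
  rw [orthonormal_iff_ite]
  rintro ⟨μ', ν'⟩ ⟨μ, ν⟩
  rw [inner_toLp_toLp]
  have h : ∀ ω, conj (fourierHermite Z e μ' ν' ω) * fourierHermite Z e μ ν ω =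
      ((√(multiFactorial μ' * multiFactorial ν' : ℝ))⁻¹ *
        (√(multiFactorial μ * multiFactorial ν : ℝ))⁻¹ : ℝ) *
          (conj (prodHerm Z e μ' ν' ω) * prodHerm Z e μ ν ω) := by
    intro ω
    rw [fourierHermite_eq he.1, fourierHermite_eq he.1, map_mul, Complex.conj_ofReal]
    push_cast
    ring
  simp only [h]
  rw [integral_const_mul, hZ.integral_conj_prodHerm_mul_prodHerm he]
  by_cases hp : μ = μ' ∧ ν = ν'
  · obtain ⟨rfl, rfl⟩ := hp
    have hpos : (0 : ℝ) < multiFactorial μ * multiFactorial ν := by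
      exact_mod_cast Nat.mul_pos (multiFactorial_pos μ) (multiFactorial_pos ν)
    have h1 : (multiFactorial μ * multiFactorial ν : ℂ) =
      ((multiFactorial μ * multiFactorial ν : ℝ) : ℂ) := by push_cast; rfl
    rw [if_pos ⟨rfl, rfl⟩, if_pos rfl, ← mul_inv, Real.mul_self_sqrt hpos.le, h1,
      ← Complex.ofReal_mul, inv_mul_cancel₀ hpos.ne', Complex.ofReal_one]
  · rw [if_neg hp, mul_zero, if_neg]
    rintro ⟨⟩
    exact hp ⟨rfl, rfl⟩

theorem hermZ_mem_chaos [Nontrivial H] (m n : ℕ) (h : Complexification H) :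
    hermZ Z m n h ∈ aeSubmodule (chaos P Z m n) := by
  have hgen : ∀ h : Complexification H, ‖h‖ = √2 → hermZ Z m n h ∈ aeSubmodule (chaos P Z m n) := by
    intro h hh
    have h1 := (hZ.memAllLp_hermZ m n h).memLp_two
    refine (toLp_mem_iff h1).1 (Submodule.le_topologicalClosure _ (Submodule.subset_span
      ⟨h, hh, h1.coeFn_toLp.trans (Filter.Eventually.of_forall fun ω => ?_)⟩))
    exact (hermiteJ_eq_hermZ hh m n ω).symm
  have h2 : (√2 : ℝ) ≠ 0 := by positivity
  have hscale : ∀ h : Complexification H, h ≠ 0 →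
      ‖((√2 / ‖h‖ : ℝ) : ℂ) • h‖ = √2 := by
    intro h hh
    rw [norm_smul, Complex.norm_real, Real.norm_of_nonneg (by positivity),
      div_mul_cancel₀ _ (norm_ne_zero_iff.2 hh)]
  by_cases hh : h = 0
  · by_cases hmn : m + n = 0
    · obtain ⟨rfl, rfl⟩ := Nat.add_eq_zero_iff.1 hmn
      -- In bidegree (0, 0) the constant 1 must come from some generator, and a vector of norm √2
      -- exists only because `H` is nontrivial.
      obtain ⟨x, hx⟩ := exists_ne (0 : H)
      have hx' : Complexification.mk x 0 ≠ 0 := fun h0 => hx (congrArg Complexification.re h0)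
      have := hgen _ (hscale _ hx')
      have e : ∀ h : Complexification H, hermZ Z 0 0 h = fun _ => 1 := fun h =>
        funext (hermZ_zero_zero Z h)
      rwa [e] at this ⊢
    · subst hh
      exact aeSubmodule_congr (hZ.hermZ_zero_ae hmn).symm (aeSubmodule _).zero_mem
  · have hn : ‖h‖ ≠ 0 := norm_ne_zero_iff.2 hh
    have e : ((‖h‖ / √2 : ℝ) : ℂ) • ((√2 / ‖h‖ : ℝ) : ℂ) • h = h := by
      rw [smul_smul, ← Complex.ofReal_mul, div_mul_div_cancel₀ h2, div_self hn, Complex.ofReal_one,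
        one_smul]
    have h3 := hZ.hermZ_smul_ae ((‖h‖ / √2 : ℝ) : ℂ) m n (((√2 / ‖h‖ : ℝ) : ℂ) • h)
    rw [e] at h3
    exact aeSubmodule_congr h3.symm ((aeSubmodule _).smul_mem _ (hgen _ (hscale h hh)))

/-- One inclusion is polarization (`prodHerm_mem`); the other is the expansion of finite
combinations (`hermZ_sum_mem`) followed by the L² limit. -/
theorem closure_span_fourierHermite [Nontrivial H] (e : HilbertBasis ι ℂ (Complexification H))
    (m n : ℕ) :
    (Submodule.span ℂ (Set.range
      (fun p : {μ : ι →₀ ℕ // μ.degree = m} × {ν : ι →₀ ℕ // ν.degree = n} =>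
        (memLp_fourierHermite hZ e.orthonormal.1 p.1.1 p.2.1).toLp))).topologicalClosure =
      chaos P Z m n := by
  set V := (Submodule.span ℂ (Set.range
      (fun p : {μ : ι →₀ ℕ // μ.degree = m} × {ν : ι →₀ ℕ // ν.degree = n} =>
        (memLp_fourierHermite hZ e.orthonormal.1 p.1.1 p.2.1).toLp))).topologicalClosure with hV
  apply le_antisymm
  · refine Submodule.topologicalClosure_minimal _ (Submodule.span_le.2 ?_)
      (Submodule.isClosed_topologicalClosure _)
    rintro _ ⟨⟨⟨μ, hμ⟩, ⟨ν, hν⟩⟩, rfl⟩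
    refine (toLp_mem_iff _).2 ?_
    have h1 := (aeSubmodule (chaos P Z m n)).smul_mem
      (((√(multiFactorial μ * multiFactorial ν : ℝ))⁻¹ : ℝ) : ℂ)
      (hZ.prodHerm_mem e.orthonormal (hermZ_mem_chaos hZ m n) hμ hν)
    convert h1 using 1
    ext ω
    exact fourierHermite_eq e.orthonormal.1 μ ν ω
  · refine Submodule.topologicalClosure_minimal _ (Submodule.span_le.2 ?_)
      (Submodule.isClosed_topologicalClosure _)
    rintro F ⟨h, hh, hF⟩
    have h1 : hermZ Z m n h ∈ aeSubmodule V := by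
      refine hZ.hermZ_mem_of_forall_finset (Submodule.isClosed_topologicalClosure _) e
        (hZ.hermZ_sum_mem e.orthonormal fun μ ν hμ hν => ?_) h
      have h2 : fourierHermite Z e μ ν ∈ aeSubmodule V :=
        (toLp_mem_iff (memLp_fourierHermite hZ e.orthonormal.1 μ ν)).1
          (Submodule.le_topologicalClosure _ (Submodule.subset_span ⟨(⟨μ, hμ⟩, ⟨ν, hν⟩), rfl⟩))
      have hpos : (0 : ℝ) < √(multiFactorial μ * multiFactorial ν : ℝ) := by
        have := Nat.mul_pos (multiFactorial_pos μ) (multiFactorial_pos ν)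
        exact Real.sqrt_pos.2 (by exact_mod_cast this)
      convert (aeSubmodule V).smul_mem ((√(multiFactorial μ * multiFactorial ν : ℝ) : ℝ) : ℂ) h2
        using 1
      ext ω
      rw [Pi.smul_apply, smul_eq_mul, fourierHermite_eq e.orthonormal.1, ← mul_assoc,
        ← Complex.ofReal_mul, mul_inv_cancel₀ hpos.ne', Complex.ofReal_one, one_mul]
    obtain ⟨G, hG, hGh⟩ := h1
    have : F = G := Lp.ext (hF.trans (Filter.EventuallyEq.trans
      (Filter.Eventually.of_forall fun ω => hermiteJ_eq_hermZ hh m n ω) hGh.symm))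
    rw [this]
    exact hG

end Chaos

/-! ### Hilbert bases and multiples of isometries -/

section ScaledIsometry

/-- Two Hilbert bases with the same index set identify both spaces with the same ℓ²; the resulting
unitary is multiplied by `r`. -/
theorem exists_scaled_isometry {T E F : Type*} [NormedAddCommGroup E] [InnerProductSpace ℂ E]
    [NormedAddCommGroup F] [InnerProductSpace ℂ F] (b : HilbertBasis T ℂ E)
    (C : Submodule ℂ F) (c : HilbertBasis T ℂ C) {r : ℝ} (hr : 0 < r) :
    ∃ I : E →L[ℂ] F, (∀ p, I (b p) = (r : ℂ) • (c p : F)) ∧ (∀ f, ‖I f‖ = r * ‖f‖) ∧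
      LinearMap.range (I : E →ₗ[ℂ] F) = C := by
  let U : E ≃ₗᵢ[ℂ] C := b.repr.trans c.repr.symm
  have hU : ∀ p, U (b p) = c p := fun p => by
    classical
    rw [LinearIsometryEquiv.trans_apply, b.repr_self, c.repr_symm_single]
  have hr' : (r : ℂ) ≠ 0 := by exact_mod_cast hr.ne'
  refine ⟨(r : ℂ) • (C.subtypeL ∘L U.toContinuousLinearEquiv.toContinuousLinearMap),
    fun p => ?_, fun f => ?_, ?_⟩
  · change (r : ℂ) • ((U (b p) : C) : F) = _
    rw [hU]
  · change ‖(r : ℂ) • ((U f : C) : F)‖ = _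
    rw [norm_smul, Complex.norm_real, Real.norm_of_nonneg hr.le]
    exact congrArg (r * ·) (U.norm_map f)
  · ext x
    constructor
    · rintro ⟨f, rfl⟩
      exact C.smul_mem _ (U f).2
    · intro hx
      refine ⟨(r : ℂ)⁻¹ • U.symm ⟨x, hx⟩, ?_⟩
      change (r : ℂ) • ((U ((r : ℂ)⁻¹ • U.symm ⟨x, hx⟩) : C) : F) = x
      rw [map_smul, U.apply_symm_apply, Submodule.coe_smul, smul_smul, mul_inv_cancel₀ hr',
        one_smul]

theorem HilbertBasis.exists_of_closure_eq {T F : Type*} [NormedAddCommGroup F]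
    [InnerProductSpace ℂ F] [CompleteSpace F] {v : T → F} (hv : Orthonormal ℂ v)
    {C : Submodule ℂ F} (hC : (Submodule.span ℂ (Set.range v)).topologicalClosure = C) :
    ∃ c : HilbertBasis T ℂ C, ∀ p, (c p : F) = v p := by
  have hcl : IsClosed (C : Set F) := hC ▸ Submodule.isClosed_topologicalClosure _
  have : CompleteSpace C := hcl.completeSpace_coe
  have hmem : ∀ p, v p ∈ C := fun p =>
    hC ▸ Submodule.le_topologicalClosure _ (Submodule.subset_span ⟨p, rfl⟩)
  let w : T → C := fun p => ⟨v p, hmem p⟩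
  have hw : Orthonormal ℂ w := ⟨fun p => hv.1 p, fun p q hpq => hv.2 hpq⟩
  have hdense : ⊤ ≤ (Submodule.span ℂ (Set.range w)).topologicalClosure := by
    set D := (Submodule.span ℂ (Set.range w)).topologicalClosure with hD
    -- Density is known in `F` but needed inside `C`. As `C` is closed, the image in `F` of a closed
    -- subspace of `C` is closed.
    have hDcl : IsClosed ((D.map C.subtype : Submodule ℂ F) : Set F) := by
      rw [Submodule.map_coe]
      exact hcl.isClosedEmbedding_subtypeVal.isClosedMap _
        (Submodule.isClosed_topologicalClosure _)
    have hle : C ≤ D.map C.subtype := by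
      conv_lhs => rw [← hC]
      refine Submodule.topologicalClosure_minimal _ (Submodule.span_le.2 ?_) hDcl
      rintro _ ⟨p, rfl⟩
      exact ⟨w p, Submodule.le_topologicalClosure _ (Submodule.subset_span ⟨p, rfl⟩), rfl⟩
    rintro ⟨x, hx⟩ _
    obtain ⟨y, hy, hyx⟩ := hle hx
    have : y = ⟨x, hx⟩ := Subtype.ext hyx
    exact this ▸ hy
  exact ⟨HilbertBasis.mk hw hdense, fun p => by rw [HilbertBasis.coe_mk]⟩

end ScaledIsometry

/-! ### The basis of the tensor space -/

section TensorBasis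

variable {K : Type*} [NormedAddCommGroup K] [InnerProductSpace ℂ K] {ι : Type*} {m n : ℕ}

theorem symmTensor_eq_of_multiIndex_eq (u w : ι → K) {a a' : Fin m → ι} {b b' : Fin n → ι}
    (ha : multiIndex a = multiIndex a') (hb : multiIndex b = multiIndex b') :
    symmTensor (fun j => u (a j)) (fun j => w (b j)) =
      symmTensor (fun j => u (a' j)) (fun j => w (b' j)) := by
  obtain ⟨σ, hσ⟩ := exists_perm_of_multiIndex_eq ha
  obtain ⟨τ, hτ⟩ := exists_perm_of_multiIndex_eq hb
  rw [symmTensor, symmTensor, ← PreTensor.symm_pure_comp_perm (fun j => u (a' j)) σ,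
    ← PreTensor.symm_pure_comp_perm (fun j => w (b' j)) τ]
  simp only [hσ, hτ]

theorem exists_multiIndex_eq_of_degree {μ : ι →₀ ℕ} (hμ : μ.degree = m) :
    ∃ a : Fin m → ι, multiIndex a = μ := by
  subst hμ
  exact exists_multiIndex_eq μ

theorem exists_hilbertBasis_symPowTensorSymPow {u w : ι → K} (hu : Orthonormal ℂ u)
    (hw : Orthonormal ℂ w) (hu' : (Submodule.span ℂ (Set.range u)).topologicalClosure = ⊤)
    (hw' : (Submodule.span ℂ (Set.range w)).topologicalClosure = ⊤) (m n : ℕ) :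
    ∃ B : HilbertBasis ({μ : ι →₀ ℕ // μ.degree = m} × {ν : ι →₀ ℕ // ν.degree = n}) ℂ
      (symPowTensorSymPow K m n), ∀ (p) (a : Fin m → ι) (b : Fin n → ι),
        multiIndex a = p.1.1 → multiIndex b = p.2.1 →
          symmTensor (fun j => u (a j)) (fun j => w (b j)) =
            ((√(multiFactorial p.1.1 * multiFactorial p.2.1 : ℝ) / √(m ! * n ! : ℝ) : ℝ) : ℂ) •
              (B p : HilbertTensor (Fin m ⊕ Fin n) K) := by
  classical
  let T := {μ : ι →₀ ℕ // μ.degree = m} × {ν : ι →₀ ℕ // ν.degree = n}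
  choose a ha using fun p : T => exists_multiIndex_eq_of_degree p.1.2
  choose b hb using fun p : T => exists_multiIndex_eq_of_degree p.2.2
  -- The norm of the basis tensor: the stabilizers contribute μ! ν! and the symmetrizations 1/(m!
  -- n!).
  let r : T → ℝ := fun p =>
    √(multiFactorial p.1.1 * multiFactorial p.2.1 : ℝ) / √(m ! * n ! : ℝ)
  have hfac : (0 : ℝ) < m ! * n ! := by positivity
  have hmult : ∀ p : T, (0 : ℝ) < multiFactorial p.1.1 * multiFactorial p.2.1 := fun p => by
    exact_mod_cast Nat.mul_pos (multiFactorial_pos _) (multiFactorial_pos _)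
  have hr : ∀ p, 0 < r p := fun p => div_pos (Real.sqrt_pos.2 (hmult p)) (Real.sqrt_pos.2 hfac)
  let s : T → HilbertTensor (Fin m ⊕ Fin n) K := fun p =>
    symmTensor (fun j => u (a p j)) (fun j => w (b p j))
  let v : T → HilbertTensor (Fin m ⊕ Fin n) K := fun p => ((r p : ℝ) : ℂ)⁻¹ • s p
  have hs : ∀ p, s p = ((r p : ℝ) : ℂ) • v p := fun p => by
    rw [smul_smul, mul_inv_cancel₀ (by exact_mod_cast (hr p).ne'), one_smul]
  have hself : ∀ p, inner ℂ (s p) (s p) = ((r p * r p : ℝ) : ℂ) := by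
    intro p
    have e : r p * r p = (multiFactorial p.1.1 * multiFactorial p.2.1 : ℝ) / (m ! * n ! : ℝ) := by
      rw [div_mul_div_comm, Real.mul_self_sqrt (hmult p).le, Real.mul_self_sqrt hfac.le]
    rw [e, inner_symmTensor, sum_perm_prod_inner_self hu, sum_perm_prod_inner_self hw, ha, hb]
    push_cast
    field_simp
  have hne : ∀ p q, p ≠ q → inner ℂ (s p) (s q) = 0 := by
    intro p q hpq
    rw [inner_symmTensor]
    by_cases h1 : p.1 = q.1
    · rw [sum_perm_prod_inner_eq_zero hw, mul_zero, mul_zero]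
      rw [hb, hb]
      exact fun h2 => hpq (Prod.ext h1 (Subtype.ext h2))
    · rw [sum_perm_prod_inner_eq_zero hu, mul_zero, zero_mul]
      rw [ha, ha]
      exact fun h2 => h1 (Subtype.ext h2)
  have hv : Orthonormal ℂ v := by
    rw [orthonormal_iff_ite]
    intro p q
    rw [inner_smul_left, inner_smul_right]
    split_ifs with hpq
    · subst hpq
      have := (hr p).ne'
      rw [hself, map_inv₀, Complex.conj_ofReal, ← Complex.ofReal_inv, ← Complex.ofReal_mul,
        ← Complex.ofReal_mul]
      field_simp
      simp
    · rw [hne p q hpq, mul_zero, mul_zero]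
  have hall : ∀ (p : T) (a' : Fin m → ι) (b' : Fin n → ι), multiIndex a' = p.1.1 →
      multiIndex b' = p.2.1 → symmTensor (fun j => u (a' j)) (fun j => w (b' j)) = s p :=
    fun p a' b' ha' hb' =>
      symmTensor_eq_of_multiIndex_eq u w (ha'.trans (ha p).symm) (hb'.trans (hb p).symm)
  have hspan : (Submodule.span ℂ (Set.range v)).topologicalClosure = symPowTensorSymPow K m n := by
    apply le_antisymm
    · refine Submodule.topologicalClosure_minimal _ (Submodule.span_le.2 ?_)
        (Submodule.isClosed_topologicalClosure _)
      rintro _ ⟨p, rfl⟩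
      exact Submodule.smul_mem _ _ (symmTensor_mem _ _)
    · refine symPowTensorSymPow_le_of_basis u w hu' hw' _
        (Submodule.isClosed_topologicalClosure _) fun a' b' => ?_
      rw [hall (⟨multiIndex a', degree_multiIndex a'⟩, ⟨multiIndex b', degree_multiIndex b'⟩)
        a' b' rfl rfl, hs]
      exact Submodule.smul_mem _ _
        (Submodule.le_topologicalClosure _ (Submodule.subset_span ⟨_, rfl⟩))
  obtain ⟨B, hB⟩ := HilbertBasis.exists_of_closure_eq hv hspan
  exact ⟨B, fun p a' b' ha' hb' => by rw [hall p a' b' ha' hb', hs, hB]⟩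

end TensorBasis

end ComplexChaos

end

/-! ### The orthonormal system of the chaos and the multiple integral -/

open ComplexChaos in
theorem proposition2p8
    {H : Type*} [NormedAddCommGroup H] [InnerProductSpace ℝ H] [CompleteSpace H]
    [TopologicalSpace.SeparableSpace H] [Nontrivial H]
    {Ω : Type*} [MeasurableSpace Ω] (P : Measure Ω) [IsProbabilityMeasure P]
    (X Y : H → Ω → ℝ) (hX : IsIsonormal X P) (hY : IsIsonormal Y P)
    (hXY : IndepFun (fun ω h => X h ω) (fun ω h => Y h ω) P)
    {ι : Type*} (e : HilbertBasis ι ℂ (Complexification H)) (m n : ℕ) :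
    -- the generators of the chaos are square integrable
    (∀ h : Complexification H,
      MemLp (fun ω => hermiteJ m n (complexIsonormal X Y h ω)) 2 P) ∧
    -- (i)
    (∃ hJ : ∀ μ ν : ι →₀ ℕ, MemLp (fourierHermite (complexIsonormal X Y) e μ ν) 2 P,
      Orthonormal ℂ (fun p : {μ : ι →₀ ℕ // μ.degree = m} × {ν : ι →₀ ℕ // ν.degree = n} =>
        (hJ p.1 p.2).toLp) ∧
      (Submodule.span ℂ (Set.range
        (fun p : {μ : ι →₀ ℕ // μ.degree = m} × {ν : ι →₀ ℕ // ν.degree = n} =>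
          (hJ p.1 p.2).toLp))).topologicalClosure = chaos P (complexIsonormal X Y) m n) ∧
    -- (ii)
    (∃ I : symPowTensorSymPow (Complexification H) m n →L[ℂ] Lp ℂ 2 P,
      IsIntegralOnBasis P (complexIsonormal X Y) e m n I ∧
      (∀ I' : symPowTensorSymPow (Complexification H) m n →L[ℂ] Lp ℂ 2 P,
        IsIntegralOnBasis P (complexIsonormal X Y) e m n I' → I' = I) ∧
      (∀ f, ‖I f‖ = √(m ! * n ! : ℝ) * ‖f‖) ∧
      LinearMap.range (I : symPowTensorSymPow (Complexification H) m n →ₗ[ℂ] Lp ℂ 2 P) =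
        chaos P (complexIsonormal X Y) m n) := by
  have hZ := isCircularIsonormal_complexIsonormal hX hY hXY
  set Z := complexIsonormal X Y with hZdef
  have he := e.orthonormal
  refine ⟨fun h => ?_, ⟨memLp_fourierHermite hZ he.1, ?_, closure_span_fourierHermite hZ e m n⟩, ?_⟩
  · simp only [hermiteJ_eq_herm]
    exact ((hZ.memAllLp h).herm (hZ.memAllLp h).star 2 m n).memLp_two
  · exact (orthonormal_fourierHermite hZ he).comp
      (fun p : {μ : ι →₀ ℕ // μ.degree = m} × {ν : ι →₀ ℕ // ν.degree = n} => (p.1.1, p.2.1))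
      fun p q hpq => Prod.ext (Subtype.ext (congrArg Prod.fst hpq))
        (Subtype.ext (congrArg Prod.snd hpq))
  · have hJ : Orthonormal ℂ
        (fun p : {μ : ι →₀ ℕ // μ.degree = m} × {ν : ι →₀ ℕ // ν.degree = n} =>
          (memLp_fourierHermite hZ he.1 p.1.1 p.2.1).toLp) :=
      (orthonormal_fourierHermite hZ he).comp
        (fun p : {μ : ι →₀ ℕ // μ.degree = m} × {ν : ι →₀ ℕ // ν.degree = n} => (p.1.1, p.2.1))
        fun p q hpq => Prod.ext (Subtype.ext (congrArg Prod.fst hpq))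
          (Subtype.ext (congrArg Prod.snd hpq))
    obtain ⟨c, hc⟩ := HilbertBasis.exists_of_closure_eq hJ (closure_span_fourierHermite hZ e m n)
    obtain ⟨B, hB⟩ := exists_hilbertBasis_symPowTensorSymPow he
      (Complexification.orthonormal_conjugate he) e.dense_span
      (Complexification.topologicalClosure_span_conjugate e.dense_span) m n
    have hfac : (0 : ℝ) < √(m ! * n ! : ℝ) := by positivity
    -- The scale √(m! n!) cancels the denominator in the norms of the basis tensors, leaving the
    -- prescribed factor √(μ! ν!).
    obtain ⟨I, hIB, hnorm, hrange⟩ := exists_scaled_isometry B (chaos P Z m n) c hfac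
    have hval : ∀ (p : {μ : ι →₀ ℕ // μ.degree = m} × {ν : ι →₀ ℕ // ν.degree = n})
        (a : Fin m → ι) (b : Fin n → ι), multiIndex a = p.1.1 → multiIndex b = p.2.1 →
        (⟨symmTensor (fun j => e (a j)) (fun j => (e (b j)).conjugate), symmTensor_mem _ _⟩ :
          symPowTensorSymPow (Complexification H) m n) =
            ((√(multiFactorial p.1.1 * multiFactorial p.2.1 : ℝ) / √(m ! * n ! : ℝ) : ℝ) : ℂ) •
              B p :=
      fun p a b ha hb => Subtype.ext (hB p a b ha hb)
    have hI : IsIntegralOnBasis P Z e m n I := by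
      rintro μ ν a b rfl rfl
      rw [hval (⟨multiIndex a, degree_multiIndex a⟩, ⟨multiIndex b, degree_multiIndex b⟩) a b
        rfl rfl, map_smul, hIB, hc, smul_smul, ← Complex.ofReal_mul, div_mul_cancel₀ _ hfac.ne']
      filter_upwards [Lp.coeFn_smul
        ((√(multiFactorial (multiIndex a) * multiFactorial (multiIndex b) : ℝ) : ℝ) : ℂ)
        (memLp_fourierHermite hZ he.1 (multiIndex a) (multiIndex b)).toLp,
        (memLp_fourierHermite hZ he.1 (multiIndex a) (multiIndex b)).coeFn_toLp] with ω h1 h2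
      rw [h1, Pi.smul_apply, h2, smul_eq_mul]
    refine ⟨I, hI, fun I' hI' => ?_, hnorm, hrange⟩
    -- The prescribed tensors are nonzero multiples of the vectors of `B`, whose span is dense, so
    -- the prescribed values determine the map.
    refine ContinuousLinearMap.ext_on (s := Set.range B) ?_ ?_
    · exact Submodule.dense_iff_topologicalClosure_eq_top.2 B.dense_span
    · rintro _ ⟨p, rfl⟩
      obtain ⟨a, ha⟩ := exists_multiIndex_eq_of_degree p.1.2
      obtain ⟨b, hb⟩ := exists_multiIndex_eq_of_degree p.2.2
      have h1 := Lp.ext ((hI' _ _ a b ha hb).trans (hI _ _ a b ha hb).symm)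
      rw [hval p a b ha hb, map_smul, map_smul] at h1
      refine (smul_right_injective (Lp ℂ 2 P) ?_) h1
      have hpos : (0 : ℝ) < multiFactorial p.1.1 * multiFactorial p.2.1 := by
        exact_mod_cast Nat.mul_pos (multiFactorial_pos _) (multiFactorial_pos _)
      exact_mod_cast (div_pos (Real.sqrt_pos.2 hpos) hfac).ne'
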